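/- Let $V$ be a set of $n\ge 1$ elements, $I=[1,q]$ a set of $q\ge 1$ items, $\sigma:V\to 2^{I}$, and let $\mathcal C\subseteq 2^V$ be a family of subsets, called components, that is transitive: $X,Y,Z\in\mathcal C$ and $Z\subseteq X\cap Y$ imply $X\cup Y\in\mathcal C$. Let $\rho:2^V\to\mathbb R$ be a volume function, i.e. $\rho(X)\le\rho(Y)$ whenever $X\subseteq Y\subseteq V$; assume that $\emptyset$ is not a component with $\rho(\emptyset)>0$. For $X\subseteq V$ put $I_\sigma(X)=\bigcap_{v\in X}\sigma(v)$. A solution is a component $X\in\mathcal C$ such that every component $Y\supsetneq X$ satisfies $I_\sigma(Y)\subsetneq I_\sigma(X)$; it is $\rho$-positive if $\rho(X)>0$. For $Y\subseteq V$ let $\mathcal C_{\max}(Y)$ be the family of inclusion-maximal members of $\{Z\in\mathcal C: Z\subseteq Y\}$, and let $\delta:2^V\to\mathbb N$ satisfy $|\mathcal C_{\max}(X)|\le\delta(X)$ for all $X$, $\delta(Y)\le\delta(X)$ for $Y\subseteq X$, and $\delta(V)\ge 1$. The family $\mathcal C$ is given only through two oracles: for non-empty $X\subseteq Y\subseteq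 V$, $\mathrm L_1(X,Y)$ returns some $Z\in\mathcal C_{\max}(Y)$ with $X\subseteq Z$, or $\emptyset$ if there is none, in time $\theta_{1,t}$ and space $\theta_{1,s}$; for non-empty $Y\subseteq V$, $\mathrm L_2(Y)$ returns a list of $\mathcal C_{\max}(Y)$ in time $\theta_{2,t}$ and space $\theta_{2,s}$, which includes the space for the list itself. Whether $\rho(X)>0$ can be tested in time $\theta_{\rho,t}$ and space $\theta_{\rho,s}$. Then there is an algorithm (one program for a unit-cost random access machine, for all inputs) that outputs every $\rho$-positive solution exactly once and nothing else, with delay $$O\big(q\,\theta_{2,t}+(q(n+\theta_{1,t})+\theta_{\rho,t})\,q\,\delta(V)\big)$$ and in space $$O\big((q+n+\theta_{1,s}+\theta_{2,s}+\theta_{\rho,s})\,n\big)$$ memory words, where the numbers in the words are at most of the order of the space bound, and the implied constants are absolute. The delay bounds the time before the first output, between any two consecutive outputs, and from the last output to termination. -/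

import Mathlib

/-! ### Set systems, solutions, volume functions -/

namespace TransSys

/-- A family `C` of subsets of `V` is transitive: `X ∪ Y` is a component whenever
`X`, `Y`, `Z` are components with `Z ⊆ X ∩ Y`. -/
def IsTransitive {V : Type} [DecidableEq V] (C : Finset (Finset V)) : Prop :=
  ∀ X ∈ C, ∀ Y ∈ C, ∀ Z ∈ C, Z ⊆ X ∩ Y → X ∪ Y ∈ C

/-- The family of `Y`-maximal components. -/
def maxIn {V : Type} [DecidableEq V] (C : Finset (Finset V)) (Y : Finset V) :
    Finset (Finset V) :=
  C.filter fun Z => Z ⊆ Y ∧ ∀ W ∈ C, Z ⊂ W → ¬ W ⊆ Y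

/-- The family of `Y`-maximal components that contain `X`. -/
def maxOver {V : Type} [DecidableEq V] (C : Finset (Finset V)) (X Y : Finset V) :
    Finset (Finset V) :=
  (maxIn C Y).filter fun Z => X ⊆ Z

/-- The common item set of `X` (the whole item set if `X` is empty). -/
def commonItems {V I : Type} [Fintype I] [DecidableEq I]
    (σ : V → Finset I) (X : Finset V) : Finset I :=
  Finset.univ.filter fun i => ∀ v ∈ X, i ∈ σ v

/-- A solution: a component all of whose proper superset components have a strictly smaller
common item set. -/
def IsSolution {V I : Type} [Fintype I] [DecidableEq I]
    (C : Finset (Finset V)) (σ : V → Finset I) (X : Finset V) : Prop :=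
  X ∈ C ∧ ∀ Y ∈ C, X ⊂ Y → commonItems σ Y ⊂ commonItems σ X

/-- Correctness of the first oracle: for non-empty `X ⊆ Y` it returns some `Y`-maximal component
containing `X`, or the empty set if there is none. -/
def IsOracle₁ {V : Type} [DecidableEq V] (C : Finset (Finset V))
    (L₁ : Finset V → Finset V → Finset V) : Prop :=
  ∀ X Y : Finset V, X.Nonempty → X ⊆ Y →
    L₁ X Y ∈ maxOver C X Y ∨ (maxOver C X Y = ∅ ∧ L₁ X Y = ∅)

/-- Correctness of the second oracle: for non-empty `Y` it lists the `Y`-maximal components,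
each exactly once, in some order. -/
def IsOracle₂ {V : Type} [DecidableEq V] (C : Finset (Finset V))
    (L₂ : Finset V → List (Finset V)) : Prop :=
  ∀ Y : Finset V, Y.Nonempty → (L₂ Y).Nodup ∧ ∀ Z, Z ∈ L₂ Y ↔ Z ∈ maxIn C Y

/-! ### Random access machine with oracles

A unit-cost random access machine with structured control. The elements are `0, …, n - 1`, the
items `0, …, q - 1`. A set is represented in memory by its cardinality followed by its elements in
increasing order, a list of sets by the concatenation of the representations of its members. -/

/-- The representation of a set as a sequence of words. -/
def encode {n : ℕ} (X : Finset (Fin n)) : List ℕ :=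
  X.card :: (X.sort (· ≤ ·)).map Fin.val

/-- The representation of a list of sets as a sequence of words. -/
def encodeList {n : ℕ} (l : List (Finset (Fin n))) : List ℕ :=
  l.flatMap encode

/-- The memory `m` holds the representation of the set `X` from address `a` on. -/
def Holds {n : ℕ} (m : ℕ → ℕ) (a : ℕ) (X : Finset (Fin n)) : Prop :=
  ∀ (k : ℕ) (hk : k < (encode X).length), m (a + k) = (encode X)[k]

/-- The memory `m` after the words `l` have been written from address `a` on. -/
def write (m : ℕ → ℕ) (a : ℕ) (l : List ℕ) : ℕ → ℕ :=
  fun b => if a ≤ b then l.getD (b - a) (m b) else m b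

/-- What a program has access to: the (read-only) attribute map, the two oracles, and the test for
positive volume, together with the time and the space that a call of each of these takes. -/
structure Env (n q : ℕ) where
  attr : Fin n → Finset (Fin q)
  L₁ : Finset (Fin n) → Finset (Fin n) → Finset (Fin n)
  L₂ : Finset (Fin n) → List (Finset (Fin n))
  pos : Finset (Fin n) → Prop
  time₁ : ℕ
  time₂ : ℕ
  timePos : ℕ
  space₁ : ℕ
  space₂ : ℕ
  spacePos : ℕ

/-- Instructions; all arguments but the constant in `const` are names of registers. -/
inductive Instr where
  /-- `d := c` -/
  | const (d c : ℕ)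
  /-- `d := a + b` -/
  | add (d a b : ℕ)
  /-- `d := max (a - b) 0` -/
  | sub (d a b : ℕ)
  /-- `d := a * b` -/
  | mul (d a b : ℕ)
  /-- `d := 1` if the element `v` has the item `i`, else `d := 0` -/
  | item (d v i : ℕ)
  /-- `d := mem[a]` -/
  | load (d a : ℕ)
  /-- `mem[a] := b` -/
  | store (a b : ℕ)
  /-- call the first oracle on the sets at addresses `x` and `y`, answer to address `z` -/
  | call₁ (x y z : ℕ)
  /-- call the second oracle on the set at address `y`, answer to address `z`,
  number of sets in the answer to `d` -/
  | call₂ (d y z : ℕ)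
  /-- `d := 1` if the set at address `x` has positive volume, else `d := 0` -/
  | test (d x : ℕ)
  /-- output the set at address `x` -/
  | output (x : ℕ)

/-- Programs. A branch and a loop are controlled by whether a register is non-zero. -/
inductive Prog where
  | skip
  | instr (i : Instr)
  | seq (p₁ p₂ : Prog)
  | branch (a : ℕ) (p₁ p₂ : Prog)
  | loop (a : ℕ) (p : Prog)

/-- A machine state, with the resources used so far. -/
structure State (n : ℕ) where
  /-- contents of the registers (a program mentions only finitely many of them) -/
  reg : ℕ → ℕ
  /-- contents of the memory -/
  mem : ℕ → ℕ
  /-- time elapsed -/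
  time : ℕ
  /-- all addresses accessed so far are smaller than this number -/
  used : ℕ
  /-- the largest working space of an oracle called so far -/
  work : ℕ
  /-- the largest number written so far into a register or memory cell -/
  word : ℕ
  /-- the sets output so far with the times of their output, in chronological order -/
  out : List (Finset (Fin n) × ℕ)

namespace State

/-- Let time pass. -/
def tick {n : ℕ} (s : State n) (t : ℕ) : State n :=
  { s with time := s.time + t }

/-- Record an access to the `k` addresses from `a` on. -/
def touch {n : ℕ} (s : State n) (a k : ℕ) : State n :=
  { s with used := max s.used (a + k) }

/-- Record an oracle call with working space `w`. -/
def useWork {n : ℕ} (s : State n) (w : ℕ) : State n :=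
  { s with work := max s.work w }

/-- Write `v` into the register `d`. -/
def setReg {n : ℕ} (s : State n) (d v : ℕ) : State n :=
  { s with reg := Function.update s.reg d v, word := max s.word v }

/-- Write the words `l` into the memory from address `a` on. -/
def setMem {n : ℕ} (s : State n) (a : ℕ) (l : List ℕ) : State n :=
  { s with
    mem := write s.mem a l
    used := max s.used (a + l.length)
    word := max s.word (l.foldr max 0) }

/-- Output the set `X` now. -/
def emit {n : ℕ} (s : State n) (X : Finset (Fin n)) : State n :=
  { s with out := s.out ++ [(X, s.time)] }

/-- The space used: memory cells plus working space of the oracles. -/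
def space {n : ℕ} (s : State n) : ℕ := s.used + s.work

/-- The initial state: `n` and `q` are in the registers `0` and `1`, all else is zero. -/
def init (n q : ℕ) : State n where
  reg := fun r => if r = 0 then n else if r = 1 then q else 0
  mem := fun _ => 0
  time := 0
  used := 0
  work := 0
  word := max n q
  out := []

end State

open Classical in
/-- `1` for a true proposition, `0` for a false one. -/
noncomputable def bit (P : Prop) : ℕ := if P then 1 else 0

/-- Effect of an instruction. An instruction takes one unit of time, plus the time of the oracle
for a call and the number of elements for an output. There is no successor state if an operand
does not represent a set or an oracle is called outside of its domain. -/
def Step {n q : ℕ} (E : Env n q) : Instr → State n → State n → Prop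
  | .const d c, s, s' => s' = (s.setReg d c).tick 1
  | .add d a b, s, s' => s' = (s.setReg d (s.reg a + s.reg b)).tick 1
  | .sub d a b, s, s' => s' = (s.setReg d (s.reg a - s.reg b)).tick 1
  | .mul d a b, s, s' => s' = (s.setReg d (s.reg a * s.reg b)).tick 1
  | .item d v i, s, s' =>
      s' = (s.setReg d (bit (∃ (hv : s.reg v < n) (hi : s.reg i < q),
        (⟨s.reg i, hi⟩ : Fin q) ∈ E.attr ⟨s.reg v, hv⟩))).tick 1
  | .load d a, s, s' => s' = ((s.touch (s.reg a) 1).setReg d (s.mem (s.reg a))).tick 1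
  | .store a b, s, s' => s' = (s.setMem (s.reg a) [s.reg b]).tick 1
  | .call₁ x y z, s, s' => ∃ X Y : Finset (Fin n),
      Holds s.mem (s.reg x) X ∧ Holds s.mem (s.reg y) Y ∧ X.Nonempty ∧ X ⊆ Y ∧
      s' = ((((s.touch (s.reg x) (X.card + 1)).touch (s.reg y) (Y.card + 1)).useWork
        E.space₁).setMem (s.reg z) (encode (E.L₁ X Y))).tick (E.time₁ + 1)
  | .call₂ d y z, s, s' => ∃ Y : Finset (Fin n),
      Holds s.mem (s.reg y) Y ∧ Y.Nonempty ∧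
      s' = ((((s.touch (s.reg y) (Y.card + 1)).useWork E.space₂).setMem (s.reg z)
        (encodeList (E.L₂ Y))).setReg d (E.L₂ Y).length).tick (E.time₂ + 1)
  | .test d x, s, s' => ∃ X : Finset (Fin n),
      Holds s.mem (s.reg x) X ∧
      s' = (((s.touch (s.reg x) (X.card + 1)).useWork E.spacePos).setReg d
        (bit (E.pos X))).tick (E.timePos + 1)
  | .output x, s, s' => ∃ X : Finset (Fin n),
      Holds s.mem (s.reg x) X ∧
      s' = ((s.touch (s.reg x) (X.card + 1)).tick (X.card + 1)).emit X

/-- `Run E p s s'`: the program `p`, started in the state `s`, halts in the state `s'`. Every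
evaluation of the control register of a branch or a loop takes one unit of time. -/
inductive Run {n q : ℕ} (E : Env n q) : Prog → State n → State n → Prop
  | skip (s : State n) : Run E .skip s s
  | instr {i : Instr} {s s' : State n} : Step E i s s' → Run E (.instr i) s s'
  | seq {p₁ p₂ : Prog} {s s' s'' : State n} :
      Run E p₁ s s' → Run E p₂ s' s'' → Run E (.seq p₁ p₂) s s''
  | branch_true {a : ℕ} {p₁ p₂ : Prog} {s s' : State n} :
      s.reg a ≠ 0 → Run E p₁ (s.tick 1) s' → Run E (.branch a p₁ p₂) s s'
  | branch_false {a : ℕ} {p₁ p₂ : Prog} {s s' : State n} :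
      s.reg a = 0 → Run E p₂ (s.tick 1) s' → Run E (.branch a p₁ p₂) s s'
  | loop_stop {a : ℕ} {p : Prog} {s : State n} :
      s.reg a = 0 → Run E (.loop a p) s (s.tick 1)
  | loop_step {a : ℕ} {p : Prog} {s s' s'' : State n} :
      s.reg a ≠ 0 → Run E p (s.tick 1) s' → Run E (.loop a p) s' s'' →
        Run E (.loop a p) s s''

/-- The delay of a finished run is at most `D`: the time before the first output, between any two
consecutive outputs, and from the last output to the end is at most `D`. -/
def DelayLE {n : ℕ} (s : State n) (D : ℕ) : Prop :=
  ((0 :: s.out.map Prod.snd) ++ [s.time]).IsChain fun t t' => t' ≤ t + D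

end TransSys

/-!
The search runs through a forest of positive solutions in which the children of a solution `T`
arise from an item `j` that is not common to `T`: they are maximal components among the elements of
`T` that have the item `j`. By transitivity all these components are solutions
(`IsSolution.of_mem_maxIn_restrictTo`), and a component lies in only one of them (`maxIn_unique`).
To reach every solution only once, a component `Z` is accepted as a child only if `Z` has no common
item below `j`, other than those of `T`; and the items are tried in increasing order, in a child
only those above `j`. Then the subtree below a child `Z` consists of the positive solutions inside
`Z` that agree with `Z` on the items up to `j` (`Desc`). The proper descendants of `T` split,
according to the first item by which they differ from `T`, into the subtrees of its children
(`properDesc_succ`), and the set of all positive solutions splits into the subtrees of the maximal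
components (`mem_listDesc_univ`). The test for acceptance takes `O(q n)` steps and needs no call of
the first oracle.

The machine keeps the path from the root to the current set on a stack, each level of which holds
one answer of the second oracle and five more words. Below the ground set, the sets on a path
decrease strictly, hence there are at most `n + 1` levels. The sets at every other level are output
before their subtrees and the others after theirs. Thus the time between two outputs is spent at a
bounded number of sets, apart from their subtrees: at one set it is `O(q θ₂ + (q n + θ) q δ)`, where
`θ₂` and `θ` are the times of the second oracle and of the volume test. For the proof, the time since
the last output plus the time still to be spent at the current set is bounded by a number that,
on a given instance, depends only on the parity of the level (`slackBound`).

Programs are verified with weakest preconditions (`WP`) within fixed bounds on the space and on the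
numbers. The postcondition of the whole run is carried along, so that the search through a subtree
(`Searches`) is specified by what holds when all items of the root of the subtree have been dealt
with and the remaining iterations of the loop are still to come.
-/

namespace TransSys

/-! ### Solutions and their descendants -/

set_option linter.unusedSectionVars false

section SetSystem
variable {V I : Type} [DecidableEq V] [Fintype I] [DecidableEq I]
  {C : Finset (Finset V)} {σ : V → Finset I}

theorem mem_commonItems {X : Finset V} {i : I} : i ∈ commonItems σ X ↔ ∀ v ∈ X, i ∈ σ v := by
  simp [commonItems]

theorem commonItems_anti {X Y : Finset V} (h : X ⊆ Y) : commonItems σ Y ⊆ commonItems σ X :=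
  fun _ hi => mem_commonItems.2 fun v hv => mem_commonItems.1 hi v (h hv)

theorem mem_maxIn {Y Z : Finset V} :
    Z ∈ maxIn C Y ↔ Z ∈ C ∧ Z ⊆ Y ∧ ∀ W ∈ C, Z ⊂ W → ¬ W ⊆ Y := by
  simp [maxIn]

theorem exists_maxIn_superset {X Y : Finset V} (hX : X ∈ C) (h : X ⊆ Y) :
    ∃ Z ∈ maxIn C Y, X ⊆ Z := by
  obtain ⟨Z, hXZ, hZ⟩ := (C.filter (· ⊆ Y)).exists_le_maximal (a := X) (by simp [hX, h])
  have hZ' := Finset.mem_filter.1 hZ.prop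
  refine ⟨Z, mem_maxIn.2 ⟨hZ'.1, hZ'.2, fun W hW hZW hWY => ?_⟩, hXZ⟩
  exact hZW.2 (hZ.le_of_ge (Finset.mem_filter.2 ⟨hW, hWY⟩) hZW.1)

/-- In a transitive system, a component lies in only one `Y`-maximal component. -/
theorem maxIn_unique (hC : IsTransitive C) {X Y Z Z' : Finset V} (hX : X ∈ C)
    (hZ : Z ∈ maxIn C Y) (hZ' : Z' ∈ maxIn C Y) (h : X ⊆ Z) (h' : X ⊆ Z') : Z = Z' := by
  rw [mem_maxIn] at hZ hZ'
  have hU := hC Z hZ.1 Z' hZ'.1 X hX (Finset.subset_inter h h')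
  have hUY := Finset.union_subset hZ.2.1 hZ'.2.1
  have h₁ : Z' ⊆ Z := by
    by_contra hn
    exact hZ.2.2 _ hU ⟨Finset.subset_union_left,
      fun hs => hn (Finset.subset_union_right.trans hs)⟩ hUY
  have h₂ : Z ⊆ Z' := by
    by_contra hn
    exact hZ'.2.2 _ hU ⟨Finset.subset_union_right,
      fun hs => hn (Finset.subset_union_left.trans hs)⟩ hUY
  exact h₂.antisymm h₁

theorem IsSolution.of_mem_maxIn_univ [Fintype V] {Z : Finset V} (hZ : Z ∈ maxIn C Finset.univ) :
    IsSolution C σ Z := by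
  rw [mem_maxIn] at hZ
  exact ⟨hZ.1, fun Y hY hZY => absurd (Finset.subset_univ Y) (hZ.2.2 Y hY hZY)⟩

/-- A component with the same common items as a solution contained in it is that solution. -/
theorem IsSolution.eq_of_subset {X Y : Finset V} (hX : IsSolution C σ X) (hY : Y ∈ C)
    (h : X ⊆ Y) (hI : commonItems σ X ⊆ commonItems σ Y) : Y = X := by
  by_contra hne
  exact (hX.2 Y hY (h.ssubset_of_ne (Ne.symm hne))).2 hI

/-- The elements of `T` that have the item `i`. -/
def restrictTo (σ : V → Finset I) (T : Finset V) (i : I) : Finset V := T.filter fun v => i ∈ σ v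

theorem mem_commonItems_of_subset_restrictTo {T Z : Finset V} {i : I}
    (h : Z ⊆ restrictTo σ T i) : i ∈ commonItems σ Z :=
  mem_commonItems.2 fun _ hv => (Finset.mem_filter.1 (h hv)).2

theorem subset_restrictTo {T Z : Finset V} {i : I} (h : Z ⊆ T) (hi : i ∈ commonItems σ Z) :
    Z ⊆ restrictTo σ T i :=
  fun v hv => Finset.mem_filter.2 ⟨h hv, mem_commonItems.1 hi v hv⟩

/-- The maximal components inside the elements of a solution that have one more item are
solutions. A larger component `Y` with the same common items could be united with `T`; the union
has the common items of `T`, so that `Y ⊆ T`, against maximality. -/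
theorem IsSolution.of_mem_maxIn_restrictTo (hC : IsTransitive C) {T Z : Finset V} {i : I}
    (hT : IsSolution C σ T) (hZ : Z ∈ maxIn C (restrictTo σ T i)) : IsSolution C σ Z := by
  rw [mem_maxIn] at hZ
  have hZT : Z ⊆ T := hZ.2.1.trans (Finset.filter_subset _ _)
  refine ⟨hZ.1, fun Y hY hZY => (commonItems_anti hZY.1).ssubset_of_not_subset fun hI => ?_⟩
  have hU := hC T hT.1 Y hY Z hZ.1 (Finset.subset_inter hZT hZY.1)
  have hTU : T ∪ Y = T := by
    refine hT.eq_of_subset hU Finset.subset_union_left fun k hk => mem_commonItems.2 ?_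
    intro v hv
    rcases Finset.mem_union.1 hv with hv | hv
    · exact mem_commonItems.1 hk v hv
    · exact mem_commonItems.1 (hI (commonItems_anti hZT hk)) v hv
  exact hZ.2.2 Y hY hZY (subset_restrictTo (Finset.union_eq_left.1 hTU)
    (hI (mem_commonItems_of_subset_restrictTo hZ.2.1)))

end SetSystem

section Descendants
variable {V : Type} [DecidableEq V] {q : ℕ}
  {C : Finset (Finset V)} {σ : V → Finset (Fin q)} {ρ : Finset V → ℝ}

/-- All items of `X` with numbers below `j` are items of `T`. For `X ⊆ T` this says that `X` and
`T` have the same items with numbers below `j`. -/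
def PrefixLE (σ : V → Finset (Fin q)) (j : ℕ) (X T : Finset V) : Prop :=
  ∀ i : Fin q, i.val < j → i ∈ commonItems σ X → i ∈ commonItems σ T

/-- The positive solutions inside `T` that have the same items as `T` below `j`. They form the
subtree below `T`, if `T` has been reached by adding the item `j - 1`. -/
def Desc (C : Finset (Finset V)) (σ : V → Finset (Fin q)) (ρ : Finset V → ℝ) (T : Finset V)
    (j : ℕ) : Set (Finset V) :=
  {X | IsSolution C σ X ∧ 0 < ρ X ∧ X ⊆ T ∧ PrefixLE σ j X T}

/-- The members of `Desc C σ ρ T j` other than `T`. -/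
def ProperDesc (C : Finset (Finset V)) (σ : V → Finset (Fin q)) (ρ : Finset V → ℝ)
    (T : Finset V) (j : ℕ) : Set (Finset V) :=
  {X | X ∈ Desc C σ ρ T j ∧ X ≠ T}

/-- The candidate `Z` is a child of `T`: it is positive and has no new item below `j`. -/
def Accepted (σ : V → Finset (Fin q)) (ρ : Finset V → ℝ) (T : Finset V) (j : ℕ)
    (Z : Finset V) : Prop :=
  0 < ρ Z ∧ PrefixLE σ j Z T

/-- The union of the subtrees below those sets of the list `L` that are children of `T`, where
the list arises from the item `j - 1` (or, for `j = 0`, from the whole ground set). -/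
def ListDesc (C : Finset (Finset V)) (σ : V → Finset (Fin q)) (ρ : Finset V → ℝ)
    (T : Finset V) (j : ℕ) (L : List (Finset V)) : Set (Finset V) :=
  {X | ∃ Z ∈ L, Accepted σ ρ T (j - 1) Z ∧ X ∈ Desc C σ ρ Z j}

theorem properDesc_all {T : Finset V} (hT : T ∈ C) : ProperDesc C σ ρ T q = ∅ := by
  ext X
  simp only [ProperDesc, Set.mem_ofPred_eq, Set.mem_empty_iff_false, iff_false, not_and, not_not]
  rintro ⟨hX, -, hXT, hp⟩
  exact (hX.eq_of_subset hT hXT fun i hi => hp i i.2 hi).symm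

theorem PrefixLE.mono {j j' : ℕ} {X T : Finset V} (h : PrefixLE σ j X T) (hj : j' ≤ j) :
    PrefixLE σ j' X T := fun i hi => h i (hi.trans_le hj)

theorem PrefixLE.succ {j : ℕ} (hj : j < q) {X T : Finset V} (h : PrefixLE σ j X T)
    (h' : ⟨j, hj⟩ ∈ commonItems σ X → ⟨j, hj⟩ ∈ commonItems σ T) : PrefixLE σ (j + 1) X T := by
  intro i hi hX
  rcases Nat.lt_succ_iff_lt_or_eq.1 hi with hi | hi
  · exact h i hi hX
  · obtain rfl : i = ⟨j, hj⟩ := Fin.ext hi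
    exact h' hX

theorem properDesc_succ_of_mem {T : Finset V} {j : ℕ} (hj : j < q)
    (h : ⟨j, hj⟩ ∈ commonItems σ T) : ProperDesc C σ ρ T j = ProperDesc C σ ρ T (j + 1) := by
  ext X
  refine and_congr_left' (and_congr_right' (and_congr_right' (and_congr_right' ?_)))
  exact ⟨fun hp => hp.succ hj fun _ => h, fun hp => hp.mono j.le_succ⟩

/-- A proper descendant of `T` at stage `j` either lacks the item `j`, like `T`, and remains a
descendant at the next stage, or lies below one of the children that arise from the item `j`. -/
theorem properDesc_succ (hρ : ∀ X Y : Finset V, X ⊆ Y → ρ X ≤ ρ Y)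
    {T : Finset V} {j : ℕ} (hj : j < q) (h : ⟨j, hj⟩ ∉ commonItems σ T) {L : List (Finset V)}
    (hL : ∀ Z, Z ∈ L ↔ Z ∈ maxIn C (restrictTo σ T ⟨j, hj⟩)) :
    ProperDesc C σ ρ T j = ListDesc C σ ρ T (j + 1) L ∪ ProperDesc C σ ρ T (j + 1) := by
  ext X
  constructor
  · rintro ⟨⟨hX, hpos, hXT, hp⟩, hne⟩
    by_cases hjX : ⟨j, hj⟩ ∈ commonItems σ X
    · left
      obtain ⟨Z, hZ, hXZ⟩ := exists_maxIn_superset hX.1 (subset_restrictTo hXT hjX)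
      have hZr := (mem_maxIn.1 hZ).2.1
      refine ⟨Z, (hL Z).2 hZ, ⟨hpos.trans_le (hρ _ _ hXZ), ?_⟩, hX, hpos, hXZ, ?_⟩
      · exact fun i hi hiZ => hp i hi (commonItems_anti hXZ hiZ)
      · refine PrefixLE.succ hj (fun i hi hiX => ?_)
          fun _ => mem_commonItems_of_subset_restrictTo hZr
        exact commonItems_anti (hZr.trans (Finset.filter_subset _ _)) (hp i hi hiX)
    · exact Or.inr ⟨⟨hX, hpos, hXT, hp.succ hj fun h' => absurd h' hjX⟩, hne⟩
  · rintro (⟨Z, hZ, ⟨-, hZp⟩, hX, hpos, hXZ, hp⟩ | ⟨⟨hX, hpos, hXT, hp⟩, hne⟩)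
    · have hZr := (mem_maxIn.1 ((hL Z).1 hZ)).2.1
      have hZT := hZr.trans (Finset.filter_subset _ _)
      refine ⟨⟨hX, hpos, hXZ.trans hZT, fun i hi hiX => hZp i hi (hp i (hi.trans j.lt_succ_self)
        hiX)⟩, ?_⟩
      rintro rfl
      exact h (mem_commonItems_of_subset_restrictTo (hXZ.trans hZr))
    · exact ⟨⟨hX, hpos, hXT, hp.mono j.le_succ⟩, hne⟩

theorem disjoint_listDesc_properDesc {T : Finset V} {j : ℕ} (hj : j < q)
    (h : ⟨j, hj⟩ ∉ commonItems σ T) {L : List (Finset V)}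
    (hL : ∀ Z, Z ∈ L ↔ Z ∈ maxIn C (restrictTo σ T ⟨j, hj⟩)) :
    Disjoint (ListDesc C σ ρ T (j + 1) L) (ProperDesc C σ ρ T (j + 1)) := by
  rw [Set.disjoint_left]
  rintro X ⟨Z, hZ, -, -, -, hXZ, -⟩ ⟨⟨-, -, -, hp⟩, -⟩
  exact h (hp ⟨j, hj⟩ j.lt_succ_self (mem_commonItems_of_subset_restrictTo
    (hXZ.trans (mem_maxIn.1 ((hL Z).1 hZ)).2.1)))

theorem disjoint_desc (hC : IsTransitive C) {Y Z Z' : Finset V} (hZ : Z ∈ maxIn C Y)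
    (hZ' : Z' ∈ maxIn C Y) (hne : Z ≠ Z') (j : ℕ) :
    Disjoint (Desc C σ ρ Z j) (Desc C σ ρ Z' j) := by
  rw [Set.disjoint_left]
  rintro X ⟨hX, -, hXZ, -⟩ ⟨-, -, hXZ', -⟩
  exact hne (maxIn_unique hC hX.1 hZ hZ' hXZ hXZ')

theorem properDesc_succ_of_restrictTo_eq_empty
    (hρ : ∀ X Y : Finset V, X ⊆ Y → ρ X ≤ ρ Y) (h0 : ∅ ∈ C → ρ ∅ ≤ 0)
    {T : Finset V} (hT : T.Nonempty) {j : ℕ} (hj : j < q) (h : restrictTo σ T ⟨j, hj⟩ = ∅) :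
    ProperDesc C σ ρ T j = ProperDesc C σ ρ T (j + 1) := by
  have hjT : ⟨j, hj⟩ ∉ commonItems σ T := fun hi => by
    have := subset_restrictTo subset_rfl hi
    rw [h, Finset.subset_empty] at this
    exact hT.ne_empty this
  rw [properDesc_succ hρ hj hjT (L := (maxIn C (restrictTo σ T ⟨j, hj⟩)).toList) (by simp)]
  convert Set.empty_union _
  ext X
  simp only [Set.mem_empty_iff_false, iff_false]
  rintro ⟨Z, hZ, hpos, -⟩
  have hZ' := mem_maxIn.1 (Finset.mem_toList.1 hZ)
  rw [h, Finset.subset_empty] at hZ'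
  obtain rfl := hZ'.2.1
  exact absurd hpos.1 (not_lt.2 (h0 hZ'.1))

/-- The roots of the search forest are the maximal components. -/
theorem mem_listDesc_univ [Fintype V] (hρ : ∀ X Y : Finset V, X ⊆ Y → ρ X ≤ ρ Y)
    {L : List (Finset V)} (hL : ∀ Z, Z ∈ L ↔ Z ∈ maxIn C Finset.univ) (X : Finset V) :
    X ∈ ListDesc C σ ρ Finset.univ 0 L ↔ IsSolution C σ X ∧ 0 < ρ X := by
  constructor
  · rintro ⟨Z, -, -, hX, hpos, -⟩
    exact ⟨hX, hpos⟩
  · rintro ⟨hX, hpos⟩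
    obtain ⟨Z, hZ, hXZ⟩ := exists_maxIn_superset hX.1 (Finset.subset_univ X)
    exact ⟨Z, (hL Z).2 hZ, ⟨hpos.trans_le (hρ _ _ hXZ), fun i hi => absurd hi (by simp)⟩, hX,
      hpos, hXZ, fun i hi => absurd hi (by simp)⟩

theorem desc_eq_union {Z : Finset V} (hZ : IsSolution C σ Z)
    (hpos : 0 < ρ Z) (j : ℕ) : Desc C σ ρ Z j = {Z} ∪ ProperDesc C σ ρ Z j := by
  ext X
  by_cases h : X = Z
  · subst h
    have : X ∈ Desc C σ ρ X j := ⟨hZ, hpos, subset_rfl, fun _ _ h => h⟩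
    simp [this]
  · simp [ProperDesc, h]

theorem disjoint_singleton_properDesc {Z : Finset V} (j : ℕ) :
    Disjoint {Z} (ProperDesc C σ ρ Z j) :=
  Set.disjoint_singleton_left.2 fun h => h.2 rfl

theorem listDesc_nil {T : Finset V} {j : ℕ} :
    ListDesc C σ ρ T j [] = ∅ := by
  ext X
  simp [ListDesc]

theorem listDesc_cons_of_not {T Z : Finset V} {j : ℕ} {L : List (Finset V)}
    (h : ¬ Accepted σ ρ T (j - 1) Z) :
    ListDesc C σ ρ T j (Z :: L) = ListDesc C σ ρ T j L := by
  ext X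
  simp [ListDesc, h]

theorem listDesc_cons {T Z : Finset V} {j : ℕ} {L : List (Finset V)}
    (h : Accepted σ ρ T (j - 1) Z) :
    ListDesc C σ ρ T j (Z :: L) = Desc C σ ρ Z j ∪ ListDesc C σ ρ T j L := by
  ext X
  simp [ListDesc, h]

end Descendants

section Enumerations
variable {α : Type*}

/-- The list `l` contains every element of `S` exactly once and nothing else. -/
def Lists (l : List α) (S : Set α) : Prop := l.Nodup ∧ ∀ x, x ∈ l ↔ x ∈ S

theorem lists_nil : Lists [] (∅ : Set α) := ⟨List.nodup_nil, by simp⟩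

theorem lists_singleton (a : α) : Lists [a] {a} := ⟨List.nodup_singleton a, by simp⟩

theorem Lists.append {l l' : List α} {S S' : Set α} (h : Lists l S) (h' : Lists l' S')
    (hd : Disjoint S S') : Lists (l ++ l') (S ∪ S') := by
  refine ⟨List.nodup_append'.2 ⟨h.1, h'.1, fun x hx hx' => ?_⟩, fun x => ?_⟩
  · exact Set.disjoint_left.1 hd ((h.2 x).1 hx) ((h'.2 x).1 hx')
  · rw [List.mem_append, h.2, h'.2, Set.mem_union]

end Enumerations

/-! ### Configurations and weakest preconditions -/

/-- The part of a machine state on which programs act: registers, memory, clock and output. -/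
structure Cfg (n : ℕ) where
  reg : ℕ → ℕ
  mem : ℕ → ℕ
  time : ℕ
  out : List (Finset (Fin n) × ℕ)

namespace Cfg
variable {n : ℕ}

/-- Let time pass. -/
def tick (c : Cfg n) (t : ℕ) : Cfg n := { c with time := c.time + t }

/-- Write `v` into the register `d`. -/
def set (c : Cfg n) (d v : ℕ) : Cfg n := { c with reg := Function.update c.reg d v }

/-- Write the words `l` into the memory from address `a` on. -/
def put (c : Cfg n) (a : ℕ) (l : List ℕ) : Cfg n := { c with mem := write c.mem a l }

/-- Output the set `X` now. -/
def emit (c : Cfg n) (X : Finset (Fin n)) : Cfg n := { c with out := c.out ++ [(X, c.time)] }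

@[simp] theorem tick_reg (c : Cfg n) (t : ℕ) : (c.tick t).reg = c.reg := rfl
@[simp] theorem tick_mem (c : Cfg n) (t : ℕ) : (c.tick t).mem = c.mem := rfl
@[simp] theorem tick_time (c : Cfg n) (t : ℕ) : (c.tick t).time = c.time + t := rfl
@[simp] theorem tick_out (c : Cfg n) (t : ℕ) : (c.tick t).out = c.out := rfl
@[simp] theorem set_mem (c : Cfg n) (d v : ℕ) : (c.set d v).mem = c.mem := rfl
@[simp] theorem set_time (c : Cfg n) (d v : ℕ) : (c.set d v).time = c.time := rfl
@[simp] theorem set_out (c : Cfg n) (d v : ℕ) : (c.set d v).out = c.out := rfl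
@[simp] theorem put_reg (c : Cfg n) (a : ℕ) (l : List ℕ) : (c.put a l).reg = c.reg := rfl
@[simp] theorem put_time (c : Cfg n) (a : ℕ) (l : List ℕ) : (c.put a l).time = c.time := rfl
@[simp] theorem put_out (c : Cfg n) (a : ℕ) (l : List ℕ) : (c.put a l).out = c.out := rfl
@[simp] theorem put_mem (c : Cfg n) (a : ℕ) (l : List ℕ) :
    (c.put a l).mem = write c.mem a l := rfl
@[simp] theorem emit_reg (c : Cfg n) (X : Finset (Fin n)) : (c.emit X).reg = c.reg := rfl
@[simp] theorem emit_mem (c : Cfg n) (X : Finset (Fin n)) : (c.emit X).mem = c.mem := rfl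
@[simp] theorem emit_time (c : Cfg n) (X : Finset (Fin n)) : (c.emit X).time = c.time := rfl
@[simp] theorem emit_out (c : Cfg n) (X : Finset (Fin n)) :
    (c.emit X).out = c.out ++ [(X, c.time)] := rfl
@[simp] theorem set_reg (c : Cfg n) (d v i : ℕ) :
    (c.set d v).reg i = if i = d then v else c.reg i := by
  simp [set, Function.update_apply]

end Cfg

/-- Forget the resource counters of a state, except for the clock. -/
def State.cfg {n : ℕ} (s : State n) : Cfg n := ⟨s.reg, s.mem, s.time, s.out⟩

/-- Bounds on the resources that a run may use. -/
structure Lim where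
  /-- bound on the numbers -/
  word : ℕ
  /-- bound on the addresses -/
  used : ℕ
  /-- bound on the working space of the oracles -/
  work : ℕ

/-- The state `s` respects the limits `M`. That the current contents of registers and memory are
bounded as well makes it unnecessary to bound values that are merely copied or subtracted. -/
structure Within {n : ℕ} (M : Lim) (s : State n) : Prop where
  reg : ∀ i, s.reg i ≤ M.word
  mem : ∀ a, s.mem a ≤ M.word
  word : s.word ≤ M.word
  used : s.used ≤ M.used
  work : s.work ≤ M.work

/-- Weakest precondition for total correctness within the limits `M`: the program `p`, started in
the configuration `c`, halts, respects the limits, and ends in a configuration satisfying `Q`. -/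
def WP {n q : ℕ} (E : Env n q) (M : Lim) (p : Prog) (c : Cfg n) (Q : Cfg n → Prop) : Prop :=
  ∀ s : State n, s.cfg = c → Within M s → ∃ s', Run E p s s' ∧ Within M s' ∧ Q s'.cfg

/-- The memory `m` holds the words `l` from address `a` on. -/
def HoldsL (m : ℕ → ℕ) (a : ℕ) (l : List ℕ) : Prop :=
  ∀ (k : ℕ) (hk : k < l.length), m (a + k) = l[k]

section Memory

theorem write_lt (m : ℕ → ℕ) {a b : ℕ} (l : List ℕ) (h : b < a) : write m a l b = m b := by
  simp [write, Nat.not_le.2 h]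

theorem write_singleton (m : ℕ → ℕ) (a v b : ℕ) :
    write m a [v] b = if b = a then v else m b := by
  unfold write
  rcases lt_trichotomy b a with h | h | h
  · simp [Nat.not_le.2 h, h.ne]
  · simp [h]
  · have : b - a ≠ 0 := by omega
    obtain ⟨k, hk⟩ := Nat.exists_eq_succ_of_ne_zero this
    simp [h.le, h.ne', hk]

theorem HoldsL.write (m : ℕ → ℕ) (a : ℕ) (l : List ℕ) : HoldsL (TransSys.write m a l) a l := by
  intro k hk
  simp [TransSys.write, hk]

theorem HoldsL.congr {m m' : ℕ → ℕ} {a : ℕ} {l : List ℕ} (h : HoldsL m a l)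
    (hm : ∀ b, a ≤ b → b < a + l.length → m' b = m b) : HoldsL m' a l := by
  intro k hk
  rw [hm _ (by omega) (by omega), h k hk]

theorem holdsL_nil (m : ℕ → ℕ) (a : ℕ) : HoldsL m a [] := by
  intro k hk
  simp at hk

theorem holdsL_cons {m : ℕ → ℕ} {a x : ℕ} {l : List ℕ} :
    HoldsL m a (x :: l) ↔ m a = x ∧ HoldsL m (a + 1) l := by
  constructor
  · intro h
    refine ⟨h 0 (by simp), fun k hk => ?_⟩
    have := h (k + 1) (by simpa using hk)
    simpa [add_assoc, add_comm 1 k] using this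
  · rintro ⟨h0, h⟩ k hk
    cases k with
    | zero => simpa using h0
    | succ k =>
      have := h k (by simpa using hk)
      simpa [add_assoc, add_comm 1 k] using this

theorem holdsL_append {m : ℕ → ℕ} {l l' : List ℕ} {a : ℕ} :
    HoldsL m a (l ++ l') ↔ HoldsL m a l ∧ HoldsL m (a + l.length) l' := by
  induction l generalizing a with
  | nil => simp [holdsL_nil]
  | cons x l ih => simp [holdsL_cons, ih, and_assoc, add_assoc, add_comm 1]

theorem write_le {m : ℕ → ℕ} {a : ℕ} {l : List ℕ} {w : ℕ} (hm : ∀ b, m b ≤ w)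
    (hl : ∀ x ∈ l, x ≤ w) (b : ℕ) : write m a l b ≤ w := by
  unfold write
  split
  · rw [List.getD_eq_getElem?_getD]
    cases h : l[b - a]? with
    | none => exact hm b
    | some x => exact hl x (List.mem_of_getElem? h)
  · exact hm b

theorem foldr_max_le {l : List ℕ} {w : ℕ} (hl : ∀ x ∈ l, x ≤ w) : l.foldr max 0 ≤ w := by
  induction l with
  | nil => simp
  | cons x l ih => simp_all

end Memory

section Rules
variable {n q : ℕ} {E : Env n q} {M : Lim} {c : Cfg n} {Q : Cfg n → Prop}

theorem wp_skip (h : Q c) : WP E M .skip c Q := by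
  rintro s rfl hs
  exact ⟨s, .skip s, hs, h⟩

theorem wp_seq {p₁ p₂ : Prog} (h : WP E M p₁ c fun c' => WP E M p₂ c' Q) :
    WP E M (.seq p₁ p₂) c Q := by
  intro s hc hs
  obtain ⟨s₁, r₁, hs₁, h₁⟩ := h s hc hs
  obtain ⟨s₂, r₂, hs₂, h₂⟩ := h₁ s₁ rfl hs₁
  exact ⟨s₂, .seq r₁ r₂, hs₂, h₂⟩

theorem Within.tick {s : State n} (hs : Within M s) (t : ℕ) : Within M (s.tick t) :=
  ⟨hs.reg, hs.mem, hs.word, hs.used, hs.work⟩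

theorem Within.touch {s : State n} (hs : Within M s) {a k : ℕ} (h : a + k ≤ M.used) :
    Within M (s.touch a k) :=
  ⟨hs.reg, hs.mem, hs.word, max_le hs.used h, hs.work⟩

theorem Within.useWork {s : State n} (hs : Within M s) {w : ℕ} (h : w ≤ M.work) :
    Within M (s.useWork w) :=
  ⟨hs.reg, hs.mem, hs.word, hs.used, max_le hs.work h⟩

theorem Within.setReg {s : State n} (hs : Within M s) {d v : ℕ} (h : v ≤ M.word) :
    Within M (s.setReg d v) := by
  refine ⟨fun i => ?_, hs.mem, max_le hs.word h, hs.used, hs.work⟩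
  simp only [State.setReg, Function.update_apply]
  split
  · exact h
  · exact hs.reg i

theorem Within.setMem {s : State n} (hs : Within M s) {a : ℕ} {l : List ℕ}
    (hl : ∀ x ∈ l, x ≤ M.word) (hu : a + l.length ≤ M.used) : Within M (s.setMem a l) :=
  ⟨hs.reg, write_le hs.mem hl, max_le hs.word (foldr_max_le hl), max_le hs.used hu, hs.work⟩

theorem wp_branch {a : ℕ} {p₁ p₂ : Prog} (h₁ : c.reg a ≠ 0 → WP E M p₁ (c.tick 1) Q)
    (h₂ : c.reg a = 0 → WP E M p₂ (c.tick 1) Q) : WP E M (.branch a p₁ p₂) c Q := by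
  rintro s rfl hs
  by_cases ha : s.reg a = 0
  · obtain ⟨s', r, h⟩ := h₂ ha (s.tick 1) rfl (hs.tick 1)
    exact ⟨s', .branch_false ha r, h⟩
  · obtain ⟨s', r, h⟩ := h₁ ha (s.tick 1) rfl (hs.tick 1)
    exact ⟨s', .branch_true ha r, h⟩

theorem wp_loop_stop {a : ℕ} {p : Prog} (ha : c.reg a = 0) (h : Q (c.tick 1)) :
    WP E M (.loop a p) c Q := by
  rintro s rfl hs
  exact ⟨s.tick 1, Run.loop_stop ha, hs.tick 1, h⟩

theorem wp_loop_step {a : ℕ} {p : Prog} (ha : c.reg a ≠ 0)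
    (h : WP E M p (c.tick 1) fun c' => WP E M (.loop a p) c' Q) : WP E M (.loop a p) c Q := by
  rintro s rfl hs
  obtain ⟨s₁, r₁, hs₁, h₁⟩ := h (s.tick 1) rfl (hs.tick 1)
  obtain ⟨s₂, r₂, h₂⟩ := h₁ s₁ rfl hs₁
  exact ⟨s₂, .loop_step ha r₁ r₂, h₂⟩

theorem wp_const {d v : ℕ} (hv : v ≤ M.word) (h : Q ((c.set d v).tick 1)) :
    WP E M (.instr (.const d v)) c Q := by
  rintro s rfl hs
  exact ⟨_, .instr rfl, (hs.setReg hv).tick 1, h⟩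

theorem wp_add {d a b : ℕ} (hv : c.reg a + c.reg b ≤ M.word)
    (h : Q ((c.set d (c.reg a + c.reg b)).tick 1)) : WP E M (.instr (.add d a b)) c Q := by
  rintro s rfl hs
  exact ⟨_, .instr rfl, (hs.setReg hv).tick 1, h⟩

/-- Adding zero serves as an instruction that copies a register. -/
theorem wp_move {d a b : ℕ} (hb : c.reg b = 0) (h : Q ((c.set d (c.reg a)).tick 1)) :
    WP E M (.instr (.add d a b)) c Q := by
  rintro s rfl hs
  have hb' : s.reg b = 0 := hb
  refine ⟨_, .instr rfl, (hs.setReg ?_).tick 1, ?_⟩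
  · rw [hb']
    exact hs.reg a
  · have h' : Q ((s.setReg d (s.reg a)).tick 1).cfg := h
    simpa [hb'] using h'

theorem wp_sub {d a b : ℕ} (h : Q ((c.set d (c.reg a - c.reg b)).tick 1)) :
    WP E M (.instr (.sub d a b)) c Q := by
  rintro s rfl hs
  exact ⟨_, .instr rfl, (hs.setReg ((Nat.sub_le _ _).trans (hs.reg a))).tick 1, h⟩

theorem wp_mul {d a b : ℕ} (hv : c.reg a * c.reg b ≤ M.word)
    (h : Q ((c.set d (c.reg a * c.reg b)).tick 1)) : WP E M (.instr (.mul d a b)) c Q := by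
  rintro s rfl hs
  exact ⟨_, .instr rfl, (hs.setReg hv).tick 1, h⟩

theorem bit_le_one (P : Prop) : bit P ≤ 1 := by
  unfold bit
  split <;> simp

@[simp] theorem bit_eq_zero {P : Prop} : bit P = 0 ↔ ¬ P := by
  unfold bit
  split <;> simp_all

theorem bit_mul (P P' : Prop) : bit P * bit P' = bit (P ∧ P') := by
  unfold bit
  split_ifs <;> simp_all

/-- The number `v` names an element that has the item with number `i`. -/
def HasItem (E : Env n q) (v i : ℕ) : Prop :=
  ∃ (hv : v < n) (hi : i < q), (⟨i, hi⟩ : Fin q) ∈ E.attr ⟨v, hv⟩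

theorem wp_item {d v i : ℕ} (hM : 1 ≤ M.word)
    (h : Q ((c.set d (bit (HasItem E (c.reg v) (c.reg i)))).tick 1)) :
    WP E M (.instr (.item d v i)) c Q := by
  rintro s rfl hs
  exact ⟨_, .instr rfl, (hs.setReg ((bit_le_one _).trans hM)).tick 1, h⟩

theorem wp_load {d a : ℕ} (ha : c.reg a + 1 ≤ M.used)
    (h : Q ((c.set d (c.mem (c.reg a))).tick 1)) : WP E M (.instr (.load d a)) c Q := by
  rintro s rfl hs
  exact ⟨_, .instr rfl, ((hs.touch ha).setReg (hs.mem _)).tick 1, h⟩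

theorem wp_store {a b : ℕ} (ha : c.reg a + 1 ≤ M.used)
    (h : Q ((c.put (c.reg a) [c.reg b]).tick 1)) : WP E M (.instr (.store a b)) c Q := by
  rintro s rfl hs
  refine ⟨_, .instr rfl, (hs.setMem ?_ ha).tick 1, h⟩
  simpa using hs.reg b

theorem wp_call₂ {d y z : ℕ} {Y : Finset (Fin n)} (hY : Holds c.mem (c.reg y) Y)
    (hne : Y.Nonempty) (hy : c.reg y + (Y.card + 1) ≤ M.used) (hw : E.space₂ ≤ M.work)
    (hz : c.reg z + (encodeList (E.L₂ Y)).length ≤ M.used)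
    (hl : ∀ x ∈ encodeList (E.L₂ Y), x ≤ M.word) (hd : (E.L₂ Y).length ≤ M.word)
    (h : Q (((c.put (c.reg z) (encodeList (E.L₂ Y))).set d (E.L₂ Y).length).tick
      (E.time₂ + 1))) : WP E M (.instr (.call₂ d y z)) c Q := by
  rintro s rfl hs
  exact ⟨_, .instr ⟨Y, hY, hne, rfl⟩,
    ((((hs.touch hy).useWork hw).setMem hl hz).setReg hd).tick _, h⟩

theorem wp_test {d x : ℕ} {X : Finset (Fin n)} (hX : Holds c.mem (c.reg x) X)
    (hx : c.reg x + (X.card + 1) ≤ M.used) (hw : E.spacePos ≤ M.work) (hM : 1 ≤ M.word)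
    (h : Q ((c.set d (bit (E.pos X))).tick (E.timePos + 1))) :
    WP E M (.instr (.test d x)) c Q := by
  rintro s rfl hs
  exact ⟨_, .instr ⟨X, hX, rfl⟩,
    (((hs.touch hx).useWork hw).setReg ((bit_le_one _).trans hM)).tick _, h⟩

theorem wp_output {x : ℕ} {X : Finset (Fin n)} (hX : Holds c.mem (c.reg x) X)
    (hx : c.reg x + (X.card + 1) ≤ M.used) (h : Q ((c.tick (X.card + 1)).emit X)) :
    WP E M (.instr (.output x)) c Q := by
  rintro s rfl hs
  have h' := (hs.touch hx).tick (X.card + 1)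
  exact ⟨_, .instr ⟨X, hX, rfl⟩, ⟨h'.reg, h'.mem, h'.word, h'.used, h'.work⟩, h⟩

end Rules

/-! ### Representation of sets -/

section Words
variable {n q : ℕ}

/-- The elements of a set in increasing order, as words. -/
def elems (X : Finset (Fin n)) : List ℕ := (X.sort (· ≤ ·)).map Fin.val

theorem encode_eq (X : Finset (Fin n)) : encode X = X.card :: elems X := rfl

@[simp] theorem length_elems (X : Finset (Fin n)) : (elems X).length = X.card := by simp [elems]

theorem mem_elems {X : Finset (Fin n)} {v : ℕ} :
    v ∈ elems X ↔ ∃ h : v < n, (⟨v, h⟩ : Fin n) ∈ X := by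
  simp only [elems, List.mem_map, Finset.mem_sort]
  constructor
  · rintro ⟨x, hx, rfl⟩
    exact ⟨x.2, hx⟩
  · rintro ⟨h, hv⟩
    exact ⟨_, hv, rfl⟩

theorem holds_iff {m : ℕ → ℕ} {a : ℕ} {X : Finset (Fin n)} :
    Holds m a X ↔ m a = X.card ∧ HoldsL m (a + 1) (elems X) :=
  holdsL_cons (l := elems X)

theorem Holds.congr {m m' : ℕ → ℕ} {a b : ℕ} {X : Finset (Fin n)} (h : Holds m a X)
    (hb : a + X.card + 1 ≤ b) (hm : ∀ k < b, m' k = m k) : Holds m' a X := by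
  refine HoldsL.congr (l := encode X) h fun k _ hk => hm k ?_
  simp only [encode_eq, List.length_cons, length_elems] at hk
  omega

theorem elems_univ : elems (Finset.univ : Finset (Fin n)) = List.range n := by
  rw [elems, Fin.sort_univ, List.map_coe_finRange_eq_range]

theorem elems_filter (X : Finset (Fin n)) (p : Fin n → Prop) [DecidablePred p]
    (p' : ℕ → Prop) [DecidablePred p'] (h : ∀ v : Fin n, p' v ↔ p v) :
    elems (X.filter p) = (elems X).filter p' := by
  have key : (X.filter p).sort (· ≤ ·) = (X.sort (· ≤ ·)).filter fun v => decide (p v) := by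
    refine List.Perm.eq_of_pairwise (le := (· ≤ ·)) (fun a b _ _ => le_antisymm)
      (Finset.pairwise_sort _ _) ((Finset.pairwise_sort _ _).filter _) ?_
    rw [← Multiset.coe_eq_coe, Finset.sort_eq, ← Multiset.filter_coe, Finset.sort_eq]
    rfl
  rw [elems, key, elems, List.filter_map]
  congr 1
  refine List.filter_congr fun v _ => ?_
  simp [h]

theorem card_le (X : Finset (Fin n)) : X.card ≤ n := by
  simpa using Finset.card_le_univ X

theorem encodeList_cons (X : Finset (Fin n)) (L : List (Finset (Fin n))) :
    encodeList (X :: L) = encode X ++ encodeList L := rfl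

theorem length_encode (X : Finset (Fin n)) : (encode X).length = X.card + 1 := by
  simp [encode_eq]

theorem le_of_mem_encodeList {L : List (Finset (Fin n))} {x : ℕ} (hx : x ∈ encodeList L) :
    x ≤ n := by
  obtain ⟨X, -, hX⟩ := List.mem_flatMap.1 hx
  rcases List.mem_cons.1 (encode_eq X ▸ hX) with rfl | h
  · exact card_le X
  · exact (mem_elems.1 h).1.le

theorem length_le_length_encodeList (L : List (Finset (Fin n))) :
    L.length ≤ (encodeList L).length := by
  induction L with
  | nil => simp
  | cons X L ih =>
    rw [encodeList_cons, List.length_append, length_encode, List.length_cons]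
    omega

theorem hasItem_iff {E : Env n q} {v : Fin n} {i : Fin q} :
    HasItem E v i ↔ i ∈ E.attr v := by
  simp [HasItem]

theorem forall_hasItem_iff {E : Env n q} {X : Finset (Fin n)} {i : Fin q} :
    (∀ v ∈ elems X, HasItem E v i) ↔ i ∈ commonItems E.attr X := by
  rw [mem_commonItems]
  constructor
  · exact fun h v hv => hasItem_iff.1 (h v (mem_elems.2 ⟨v.2, hv⟩))
  · intro h v hv
    obtain ⟨hv, hX⟩ := mem_elems.1 hv
    exact (hasItem_iff (v := ⟨v, hv⟩)).2 (h _ hX)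

end Words

/-! ### The program

Register 0 holds `n`, register 1 holds `q`, register 2 holds 1 and register 3 holds 0. The state of
the search is kept in the registers

* 5: address of the current set, 6: first address free for its candidates,
* 7: depth, 8: parity, 9: next item,
* 10: number of candidates waiting, 11: address of the next candidate, 12: end of the list.

All other registers are for intermediate results; `allHave` uses those from 30 on, so that it can
be called with operands in lower registers. -/

/-- Straight-line code. -/
def block : List Instr → Prog
  | [] => .skip
  | i :: l => .seq (.instr i) (block l)

/-- Set register 30 to 1 if all elements of the set at address `reg p` have the item `reg i`,
else to 0. -/
def allHave (p i : ℕ) : Prog :=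
  .seq (block [.load 31 p, .add 32 p 3, .const 30 1])
    (.loop 31 (block [.add 32 32 2, .load 33 32, .item 33 33 i, .mul 30 30 33, .sub 31 31 2]))

/-- Set register 20 to 1 if every item below `reg 9 - 1` that is common to the set at address
`reg 11` is common to the set at address `reg 5`, else to 0. -/
def prefixTest : Prog :=
  .seq (block [.const 20 1, .sub 21 9 2])
    (.loop 21 (.seq (block [.sub 21 21 2]) (.seq (allHave 11 21) (.seq (block [.add 22 30 3])
      (.seq (allHave 5 21) (block [.sub 22 22 30, .sub 22 2 22, .mul 20 20 22]))))))

/-- Set register 12 to the end of the list of `reg 10` sets that starts at address `reg 6`. -/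
def listEnd : Prog :=
  .seq (block [.add 12 6 3, .add 20 10 3])
    (.loop 20 (block [.load 21 12, .add 12 12 21, .add 12 12 2, .sub 20 20 2]))

/-- Write to address `reg 6` the set of those elements of the set at address `reg 5` that have
the item `reg 9`, and its cardinality to register 13. Every element is written to the next cell,
but only the elements that have the item make the output pointer advance. -/
def restrict : Prog :=
  .seq (block [.load 20 5, .add 21 5 3, .add 22 6 3])
    (.seq (.loop 20 (block [.add 21 21 2, .load 23 21, .add 24 22 2, .store 24 23, .item 23 23 9,
        .add 22 22 23, .sub 20 20 2]))
      (block [.sub 13 22 6, .store 6 13]))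

/-- Write the set of all elements to address 0. -/
def writeUniv : Prog :=
  .seq (block [.store 3 0, .add 20 0 3])
    (.loop 20 (block [.sub 21 20 2, .store 20 21, .sub 20 20 2]))

/-- Advance from the item `reg 9` to the next one. If the elements of the current set that have
the item form a non-empty proper subset (the product in register 14 is non-zero), fetch the list of
the maximal components inside; the answer of the oracle overwrites the subset. -/
def nextItem : Prog :=
  .seq restrict (.seq (block [.add 9 9 2, .load 14 5, .sub 14 14 13, .mul 14 14 13])
    (.branch 14 (.seq (block [.call₂ 10 6 6, .add 11 6 3]) listEnd) .skip))

/-- Save the state of the current set at the end of its list, make the set at address `reg 14` the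
current one, and output it if its parity is 0. -/
def push : Prog :=
  .seq (block [.store 12 5, .add 12 12 2, .store 12 9, .add 12 12 2, .store 12 10, .add 12 12 2,
      .store 12 11, .add 12 12 2, .store 12 6, .add 12 12 2, .add 6 12 3, .add 5 14 3,
      .const 10 0, .sub 8 2 8, .add 7 7 2])
    (.branch 8 .skip (block [.output 5]))

/-- Take the next candidate from the list, and descend to it if it is a child. -/
def candidate : Prog :=
  .seq prefixTest (.seq (block [.test 13 11, .mul 13 13 20, .add 14 11 3, .load 15 11,
      .add 11 11 15, .add 11 11 2, .sub 10 10 2])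
    (.branch 13 push .skip))

/-- Output the current set if its parity is 1, and restore the state of the set before it, which
has been saved in the five cells below `reg 6`. -/
def pop : Prog :=
  .seq (.branch 8 (block [.output 5]) .skip)
    (block [.sub 12 6 2, .load 6 12, .sub 12 12 2, .load 11 12, .sub 12 12 2, .load 10 12,
      .sub 12 12 2, .load 9 12, .sub 12 12 2, .load 5 12, .sub 8 2 8, .sub 7 7 2])

/-- One step of the depth-first search. At depth 1 the current set is the ground set, for which
only the initial list of candidates is to be dealt with and no item; hence the product. -/
def searchStep : Prog :=
  .branch 10 candidate (.seq (block [.sub 13 7 2, .sub 14 1 9, .mul 13 13 14])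
    (.branch 13 nextItem pop))

/-- The depth-first search. -/
def search : Prog := .loop 7 searchStep

/-- The whole program: fetch the list of the maximal components and search through it. -/
def enumerate : Prog :=
  .seq (block [.const 2 1]) (.seq writeUniv (.seq (block [.const 6 6, .add 6 6 0, .const 7 1])
    (.seq (.instr (.call₂ 10 5 6)) (.seq (block [.add 11 6 3]) (.seq listEnd search)))))

/-! ### Subroutines -/

section
variable {n q : ℕ} {E : Env n q} {M : Lim} {c : Cfg n} {Q : Cfg n → Prop}

theorem wp_block_nil (h : Q c) : WP E M (block []) c Q := wp_skip h

theorem wp_block_cons {i : Instr} {l : List Instr}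
    (h : WP E M (.instr i) c fun c' => WP E M (block l) c' Q) : WP E M (block (i :: l)) c Q :=
  wp_seq h

/-- Variant of `wp_block_nil` that gives the final configuration a name. -/
theorem wp_block_nil' (h : ∀ c', c' = c → Q c') : WP E M (block []) c Q := wp_skip (h c rfl)

/-! The rules for straight-line code once more, with the operands as explicit values, so that the
descriptions of configurations stay short in longer blocks. -/

theorem wp_block_add {l : List Instr} {d a b : ℕ} (x y : ℕ) (ha : c.reg a = x) (hb : c.reg b = y)
    (hv : x + y ≤ M.word) (h : WP E M (block l) ((c.set d (x + y)).tick 1) Q) :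
    WP E M (block (.add d a b :: l)) c Q := by
  subst ha hb
  exact wp_block_cons (wp_add hv h)

theorem wp_block_sub {l : List Instr} {d a b : ℕ} (x y : ℕ) (ha : c.reg a = x) (hb : c.reg b = y)
    (h : WP E M (block l) ((c.set d (x - y)).tick 1) Q) :
    WP E M (block (.sub d a b :: l)) c Q := by
  subst ha hb
  exact wp_block_cons (wp_sub h)

theorem wp_block_load {l : List Instr} {d a : ℕ} (x v : ℕ) (ha : c.reg a = x) (hv : c.mem x = v)
    (hu : x + 1 ≤ M.used) (h : WP E M (block l) ((c.set d v).tick 1) Q) :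
    WP E M (block (.load d a :: l)) c Q := by
  subst ha hv
  exact wp_block_cons (wp_load hu h)

theorem wp_block_store {l : List Instr} {a b : ℕ} (x v : ℕ) (ha : c.reg a = x) (hv : c.reg b = v)
    (hu : x + 1 ≤ M.used) (h : WP E M (block l) ((c.put x [v]).tick 1) Q) :
    WP E M (block (.store a b :: l)) c Q := by
  subst ha hv
  exact wp_block_cons (wp_store hu h)

theorem Run.time_le {p : Prog} {s s' : State n} (h : Run E p s s') : s.time ≤ s'.time := by
  induction h with
  | skip s => exact le_rfl
  | @instr i s s' h =>
    cases i <;> simp only [Step] at h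
    case call₁ => obtain ⟨X, Y, -, -, -, -, rfl⟩ := h; exact Nat.le_add_right _ _
    case call₂ => obtain ⟨Y, -, -, rfl⟩ := h; exact Nat.le_add_right _ _
    case test => obtain ⟨Y, -, rfl⟩ := h; exact Nat.le_add_right _ _
    case output => obtain ⟨Y, -, rfl⟩ := h; exact Nat.le_add_right _ _
    all_goals subst h; exact Nat.le_add_right _ _
  | seq _ _ h₁ h₂ => exact h₁.trans h₂
  | branch_true _ _ h => exact (Nat.le_add_right _ 1).trans h
  | branch_false _ _ h => exact (Nat.le_add_right _ 1).trans h
  | loop_stop _ => exact Nat.le_add_right _ 1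
  | loop_step _ _ _ h₁ h₂ => exact ((Nat.le_add_right _ 1).trans h₁).trans h₂

theorem wp_time_le {p : Prog} (h : WP E M p c fun c' => c.time ≤ c'.time → Q c') :
    WP E M p c Q := by
  rintro s rfl hs
  obtain ⟨s', r, hs', h'⟩ := h s rfl hs
  exact ⟨s', r, hs', h' r.time_le⟩

/-- Every address is within the bound on the numbers. -/
structure Lim.Basic (M : Lim) : Prop where
  used_le : M.used ≤ M.word
  one_le : 1 ≤ M.word

/-- Register 2 holds 1 and register 3 holds 0. -/
structure Cfg.Consts (c : Cfg n) : Prop where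
  one : c.reg 2 = 1
  zero : c.reg 3 = 0

/-- The outcome `c'` of a subroutine started in `c` that writes nothing below the address `b`,
outputs nothing, preserves the registers below `k`, and takes at most `t` units of time. -/
structure Quiet (k b t : ℕ) (c c' : Cfg n) : Prop where
  reg : ∀ i < k, c'.reg i = c.reg i
  mem : ∀ a < b, c'.mem a = c.mem a
  out : c'.out = c.out
  time_le : c'.time ≤ c.time + t

theorem wp_allHave_loop (hM : M.Basic) {i : ℕ} (hi : i < 30) (l : List ℕ) :
    ∀ (c : Cfg n) (P : Prop), HoldsL c.mem (c.reg 32 + 1) l → c.reg 31 = l.length →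
      c.reg 2 = 1 → c.reg 32 + 1 + l.length ≤ M.used → c.reg 30 = bit P →
      (∀ c' : Cfg n, c'.mem = c.mem → c'.out = c.out → c'.time = c.time + (6 * l.length + 1) →
        (∀ k < 30, c'.reg k = c.reg k) →
        c'.reg 30 = bit (P ∧ ∀ v ∈ l, HasItem E v (c.reg i)) → Q c') →
      WP E M (.loop 31 (block [.add 32 32 2, .load 33 32, .item 33 33 i, .mul 30 30 33,
        .sub 31 31 2])) c Q := by
  have h1 := hM.one_le
  have h2 := hM.used_le
  induction l with
  | nil =>
    intro c P _ hl _ _ hP hQ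
    refine wp_loop_stop (by simpa using hl) (hQ _ rfl rfl rfl (fun _ _ => rfl) ?_)
    simpa using hP
  | cons x l ih =>
    intro c P hm hl hone hu hP hQ
    rw [List.length_cons] at hu hl
    obtain ⟨hx, hm⟩ := holdsL_cons.1 hm
    have hii : i ≠ 33 := by omega
    have hii' : i ≠ 32 := by omega
    refine wp_loop_step (by omega) ?_
    refine wp_block_cons (wp_add (by simp [hone]; omega) ?_)
    refine wp_block_cons (wp_load (by simp [hone]; omega) ?_)
    refine wp_block_cons (wp_item h1 ?_)
    refine wp_block_cons (wp_mul ?_ ?_)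
    · simpa [hP, bit_mul] using (bit_le_one _).trans h1
    refine wp_block_cons (wp_sub (wp_block_nil ?_))
    refine ih _ (P ∧ HasItem E x (c.reg i)) ?_ ?_ ?_ ?_ ?_ ?_
    · simpa [hone] using hm
    · simp [hone, hl]
    · simpa using hone
    · simp [hone]; omega
    · simp [hone, hP, hx, hii, hii', bit_mul]
    · intro c' e1 e2 e3 e4 e5
      refine hQ c' (by simpa using e1) (by simpa using e2) ?_ ?_ ?_
      · rw [e3]; simp; ring
      · intro k hk
        rw [e4 k hk]
        simp [show k ≠ 31 by omega, show k ≠ 30 by omega, show k ≠ 33 by omega,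
          show k ≠ 32 by omega]
      · rw [e5]
        simp [show i ≠ 31 by omega, show i ≠ 30 by omega, hii, hii', and_assoc]

theorem wp_allHave (hM : M.Basic) (hc : c.Consts) {p i b : ℕ} (hp : p < 30) (hi : i < 30)
    {X : Finset (Fin n)} (hX : Holds c.mem (c.reg p) X) (hu : c.reg p + X.card + 1 ≤ M.used)
    (hQ : ∀ c', Quiet 30 b (6 * n + 4) c c' → c'.mem = c.mem →
      c'.reg 30 = bit (∀ v ∈ elems X, HasItem E v (c.reg i)) → Q c') :
    WP E M (allHave p i) c Q := by
  have h1 := hM.one_le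
  rw [holds_iff] at hX
  refine wp_seq ?_
  refine wp_block_cons (wp_load (by omega) ?_)
  refine wp_block_cons (wp_move (by simp [hc.zero]) ?_)
  refine wp_block_cons (wp_const h1 (wp_block_nil ?_))
  refine wp_allHave_loop hM hi (elems X) _ True ?_ ?_ ?_ ?_ ?_ ?_
  · simpa [show p ≠ 31 by omega] using hX.2
  · simpa using hX.1
  · simpa using hc.one
  · simp [show p ≠ 31 by omega]; omega
  · simp [bit]
  · intro c' e1 e2 e3 e4 e5
    refine hQ c' ⟨?_, ?_, by simpa using e2, ?_⟩ (by simpa using e1) ?_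
    · intro k hk
      rw [e4 k hk]
      simp [show k ≠ 31 by omega, show k ≠ 30 by omega, show k ≠ 32 by omega]
    · intro a _
      rw [e1]; rfl
    · rw [e3]
      have := card_le X
      simp; omega
    · rw [e5]
      simp [show i ≠ 31 by omega, show i ≠ 30 by omega, show i ≠ 32 by omega]

theorem wp_prefixTest_loop (hM : M.Basic) {X T : Finset (Fin n)} {b : ℕ} (k : ℕ) :
    ∀ (c : Cfg n) (P : Prop), c.Consts → Holds c.mem (c.reg 11) X → Holds c.mem (c.reg 5) T →
      c.reg 11 + X.card + 1 ≤ M.used → c.reg 5 + T.card + 1 ≤ M.used → c.reg 21 = k →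
      c.reg 20 = bit P →
      (∀ c' : Cfg n, Quiet 20 b (k * (12 * n + 14) + 1) c c' → c'.mem = c.mem →
        c'.reg 20 = bit (P ∧ ∀ i < k, (∀ v ∈ elems X, HasItem E v i) →
          ∀ v ∈ elems T, HasItem E v i) → Q c') →
      WP E M (.loop 21 (.seq (block [.sub 21 21 2]) (.seq (allHave 11 21)
        (.seq (block [.add 22 30 3]) (.seq (allHave 5 21)
          (block [.sub 22 22 30, .sub 22 2 22, .mul 20 20 22])))))) c Q := by
  have h1 := hM.one_le
  induction k with
  | zero =>
    intro c P _ _ _ _ _ h0 hP hQ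
    exact wp_loop_stop h0 (hQ _ ⟨fun _ _ => rfl, fun _ _ => rfl, rfl, by simp⟩ rfl
      (by simpa using hP))
  | succ k ih =>
    intro c P hc hX hT hXu hTu h21 hP hQ
    refine wp_loop_step (by omega) (wp_seq (wp_block_cons (wp_sub (wp_block_nil (wp_seq ?_)))))
    refine wp_allHave hM (b := b) ⟨by simpa using hc.one, by simpa using hc.zero⟩ (by simp)
      (by simp) (X := X) (by simpa using hX) (by simpa using hXu) ?_
    intro c₁ q₁ m₁ e₁
    have r₁ : ∀ i < 30, i ≠ 21 → c₁.reg i = c.reg i := by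
      intro i hi hi'
      rw [q₁.reg i hi]
      simp [hi']
    have r₁' : c₁.reg 21 = k := by
      rw [q₁.reg 21 (by simp)]
      simp [h21, hc.one]
    replace m₁ : c₁.mem = c.mem := m₁
    refine wp_seq (wp_block_cons (wp_move (by simp [r₁, hc.zero]) (wp_block_nil (wp_seq ?_))))
    refine wp_allHave hM (b := b) ⟨by simp [r₁, hc.one], by simp [r₁, hc.zero]⟩ (by simp)
      (by simp) (X := T) (by simpa [r₁, m₁] using hT) (by simpa [r₁] using hTu) ?_
    intro c₂ q₂ m₂ e₂
    have r₂ : ∀ i < 30, i ≠ 22 → c₂.reg i = c₁.reg i := by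
      intro i hi hi'
      rw [q₂.reg i hi]
      simp [hi']
    have r₂' : c₂.reg 22 = c₁.reg 30 := by
      rw [q₂.reg 22 (by simp)]
      simp
    replace m₂ : c₂.mem = c.mem := Eq.trans m₂ m₁
    have e₁' : c₁.reg 30 = bit (∀ v ∈ elems X, HasItem E v k) := by
      rw [e₁]; simp [h21, hc.one]
    have e₂' : c₂.reg 30 = bit (∀ v ∈ elems T, HasItem E v k) := by
      rw [e₂]; simp [r₁']
    -- the truth value of an implication from those of its two sides
    have himp : 1 - (c₂.reg 22 - c₂.reg 30) = bit ((∀ v ∈ elems X, HasItem E v k) →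
        ∀ v ∈ elems T, HasItem E v k) := by
      rw [r₂', e₁', e₂']
      unfold bit
      split_ifs <;> first | rfl | (exfalso; tauto)
    have hone : c₂.reg 2 = 1 := by rw [r₂ 2 (by simp) (by simp), r₁ 2 (by simp) (by simp), hc.one]
    have h20 : c₂.reg 20 = bit P := by
      rw [r₂ 20 (by simp) (by simp), r₁ 20 (by simp) (by simp), hP]
    refine wp_block_cons (wp_sub ?_)
    refine wp_block_cons (wp_sub ?_)
    refine wp_block_cons (wp_mul ?_ (wp_block_nil ?_))
    · simp only [Cfg.set_reg, Cfg.tick_reg]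
      simp only [reduceIte, Nat.reduceEqDiff, hone, himp, h20, bit_mul]
      exact (bit_le_one _).trans h1
    refine ih _ (P ∧ ((∀ v ∈ elems X, HasItem E v k) → ∀ v ∈ elems T, HasItem E v k))
      ⟨?_, ?_⟩ ?_ ?_ ?_ ?_ ?_ ?_ ?_
    · simpa using hone
    · simp [r₂, r₁, hc.zero]
    · simpa [r₂, r₁, m₂] using hX
    · simpa [r₂, r₁, m₂] using hT
    · simpa [r₂, r₁] using hXu
    · simpa [r₂, r₁] using hTu
    · simpa [r₂] using r₁'
    · simp [hone, himp, h20, bit_mul]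
    · intro c' q' m' e'
      have ht := q'.time_le
      have ht₁ := q₁.time_le
      have ht₂ := q₂.time_le
      simp at ht ht₁ ht₂
      refine hQ c' ⟨?_, ?_, ?_, ?_⟩ ?_ ?_
      · intro i hi
        rw [q'.reg i hi]
        simp [show i ≠ 20 by omega, show i ≠ 22 by omega,
          r₂ i (by omega) (by omega), r₁ i (by omega) (by omega)]
      · intro a ha
        rw [m']
        simp [m₂]
      · rw [q'.out]
        simpa using q₂.out.trans q₁.out
      · rw [Nat.succ_mul]; omega
      · rw [m']
        simp [m₂]
      · rw [e', and_assoc]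
        congr 2
        apply propext
        rw [Nat.forall_lt_succ_right, and_comm]

theorem wp_prefixTest (hM : M.Basic) (hc : c.Consts) {X T : Finset (Fin n)} {b : ℕ}
    (hX : Holds c.mem (c.reg 11) X) (hT : Holds c.mem (c.reg 5) T)
    (hXu : c.reg 11 + X.card + 1 ≤ M.used) (hTu : c.reg 5 + T.card + 1 ≤ M.used)
    (hj : c.reg 9 ≤ q)
    (hQ : ∀ c', Quiet 20 b (q * (12 * n + 14) + 3) c c' → c'.mem = c.mem →
      c'.reg 20 = bit (PrefixLE E.attr (c.reg 9 - 1) X T) → Q c') :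
    WP E M prefixTest c Q := by
  refine wp_seq ?_
  refine wp_block_cons (wp_const hM.one_le ?_)
  refine wp_block_cons (wp_sub (wp_block_nil ?_))
  refine wp_prefixTest_loop hM (b := b) (X := X) (T := T) (c.reg 9 - 1) _ True ⟨?_, ?_⟩
    ?_ ?_ ?_ ?_ ?_ ?_ ?_
  · simpa using hc.one
  · simpa using hc.zero
  · simpa using hX
  · simpa using hT
  · simpa using hXu
  · simpa using hTu
  · simp [hc.one]
  · simp [bit]
  · intro c' q' m' e'
    refine hQ c' ⟨?_, ?_, ?_, ?_⟩ ?_ ?_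
    · intro i hi
      rw [q'.reg i hi]
      simp [show i ≠ 20 by omega, show i ≠ 21 by omega]
    · intro a ha
      rw [m']; rfl
    · exact q'.out
    · have ht := q'.time_le
      have : (c.reg 9 - 1) * (12 * n + 14) ≤ q * (12 * n + 14) :=
        Nat.mul_le_mul_right _ (by omega)
      simp at ht
      omega
    · rw [m']; rfl
    · rw [e']
      congr 1
      apply propext
      constructor
      · rintro ⟨-, h⟩ i hi hiX
        exact forall_hasItem_iff.1 (h i hi (forall_hasItem_iff.2 hiX))
      · intro h
        refine ⟨trivial, fun i hi hiX => ?_⟩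
        have hiq : i < q := by omega
        exact (forall_hasItem_iff (i := ⟨i, hiq⟩)).2
          (h ⟨i, hiq⟩ hi ((forall_hasItem_iff (i := ⟨i, hiq⟩)).1 hiX))

theorem wp_listEnd_loop (hM : M.Basic) {b : ℕ} (L : List (Finset (Fin n))) :
    ∀ c : Cfg n, c.Consts → HoldsL c.mem (c.reg 12) (encodeList L) → c.reg 20 = L.length →
      c.reg 12 + (encodeList L).length ≤ M.used →
      (∀ c' : Cfg n, Quiet 12 b (5 * L.length + 1) c c' → c'.mem = c.mem →
        c'.reg 12 = c.reg 12 + (encodeList L).length → Q c') →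
      WP E M (.loop 20 (block [.load 21 12, .add 12 12 21, .add 12 12 2, .sub 20 20 2])) c Q := by
  have h2 := hM.used_le
  induction L with
  | nil =>
    intro c _ _ h0 _ hQ
    exact wp_loop_stop h0 (hQ _ ⟨fun _ _ => rfl, fun _ _ => rfl, rfl, by simp⟩ rfl
      (by simp [encodeList]))
  | cons X L ih =>
    intro c hc hm h20 hu hQ
    rw [encodeList_cons, holdsL_append, length_encode] at hm
    rw [encodeList_cons, List.length_append, length_encode] at hu hQ
    rw [List.length_cons] at h20 hQ
    have hX : c.mem (c.reg 12) = X.card := (holds_iff.1 hm.1).1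
    refine wp_loop_step (by omega) ?_
    refine wp_block_cons (wp_load (by simp; omega) ?_)
    refine wp_block_cons (wp_add (by simp [hX]; omega) ?_)
    refine wp_block_cons (wp_add (by simp [hX, hc.one]; omega) ?_)
    refine wp_block_cons (wp_sub (wp_block_nil ?_))
    refine ih _ ⟨?_, ?_⟩ ?_ ?_ ?_ ?_
    · simpa using hc.one
    · simpa using hc.zero
    · simpa [hX, hc.one, add_assoc] using hm.2
    · simp [h20, hc.one]
    · simp [hX, hc.one]; omega
    · intro c' q' m' e'
      have ht := q'.time_le
      simp at ht
      refine hQ c' ⟨?_, ?_, ?_, ?_⟩ ?_ ?_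
      · intro i hi
        rw [q'.reg i hi]
        simp [show i ≠ 20 by omega, show i ≠ 21 by omega, show i ≠ 12 by omega]
      · intro a ha
        rw [m']; rfl
      · exact q'.out
      · omega
      · rw [m']; rfl
      · rw [e']
        simp [hX, hc.one]; omega

theorem wp_listEnd (hM : M.Basic) (hc : c.Consts) {b : ℕ} {L : List (Finset (Fin n))}
    (hL : HoldsL c.mem (c.reg 6) (encodeList L)) (h10 : c.reg 10 = L.length)
    (hu : c.reg 6 + (encodeList L).length ≤ M.used)
    (hQ : ∀ c', Quiet 12 b (5 * L.length + 3) c c' → c'.mem = c.mem →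
      c'.reg 12 = c.reg 6 + (encodeList L).length → Q c') :
    WP E M listEnd c Q := by
  refine wp_seq ?_
  refine wp_block_cons (wp_move (by simp [hc.zero]) ?_)
  refine wp_block_cons (wp_move (by simp [hc.zero]) (wp_block_nil ?_))
  refine wp_listEnd_loop hM (b := b) L _ ⟨?_, ?_⟩ ?_ ?_ ?_ ?_
  · simpa using hc.one
  · simpa using hc.zero
  · simpa using hL
  · simpa using h10
  · simpa using hu
  · intro c' q' m' e'
    have ht := q'.time_le
    simp at ht
    refine hQ c' ⟨?_, ?_, q'.out, by omega⟩ (by rw [m']; rfl) (by simpa using e')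
    · intro i hi
      rw [q'.reg i hi]
      simp [show i ≠ 20 by omega, show i ≠ 12 by omega]
    · intro a ha
      rw [m']; rfl

open Classical in
/-- The output lies above the input, so that the input stays intact. The cell after the last word
of the output may be overwritten, too. -/
theorem wp_restrict_loop (hM : M.Basic) (l : List ℕ) :
    ∀ c : Cfg n, c.Consts → HoldsL c.mem (c.reg 21 + 1) l → c.reg 20 = l.length →
      c.reg 21 + 1 + l.length ≤ c.reg 22 → c.reg 22 + 1 + l.length ≤ M.used →
      (∀ c' : Cfg n, Quiet 13 (c.reg 22 + 1) (8 * l.length + 1) c c' →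
        c'.reg 22 = c.reg 22 + (l.filter fun v => HasItem E v (c.reg 9)).length →
        HoldsL c'.mem (c.reg 22 + 1) (l.filter fun v => HasItem E v (c.reg 9)) → Q c') →
      WP E M (.loop 20 (block [.add 21 21 2, .load 23 21, .add 24 22 2, .store 24 23,
        .item 23 23 9, .add 22 22 23, .sub 20 20 2])) c Q := by
  have h1 := hM.one_le
  have h2 := hM.used_le
  induction l with
  | nil =>
    intro c _ _ h0 _ _ hQ
    exact wp_loop_stop h0 (hQ _ ⟨fun _ _ => rfl, fun _ _ => rfl, rfl, by simp⟩
      (by simp) (holdsL_nil _ _))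
  | cons x l ih =>
    intro c hc hm h20 hs hu hQ
    rw [List.length_cons] at h20 hs hu
    obtain ⟨hx, hm⟩ := holdsL_cons.1 hm
    have hone := hc.one
    have hb := bit_le_one (HasItem E x (c.reg 9))
    refine wp_loop_step (by omega) ?_
    refine wp_block_cons (wp_add (by simp [hone]; omega) ?_)
    refine wp_block_cons (wp_load (by simp [hone]; omega) ?_)
    refine wp_block_cons (wp_add (by simp [hone]; omega) ?_)
    refine wp_block_cons (wp_store (by simp [hone]; omega) ?_)
    refine wp_block_cons (wp_item h1 ?_)
    refine wp_block_cons (wp_add (by simp [hone, hx]; omega) ?_)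
    refine wp_block_cons (wp_sub (wp_block_nil ?_))
    refine ih _ ⟨?_, ?_⟩ ?_ ?_ ?_ ?_ ?_
    · simpa using hc.one
    · simpa using hc.zero
    · have : HoldsL (write c.mem (c.reg 22 + 1) [x]) (c.reg 21 + 1 + 1) l :=
        hm.congr fun a _ ha => write_lt _ _ (by omega)
      simpa [hone, hx] using this
    · simp [h20, hone]
    · simp [hone]; omega
    · simp [hone, hx]; omega
    · intro c' q' e' m'
      have ht := q'.time_le
      simp at ht
      have hmem : ∀ a < c.reg 22 + bit (HasItem E x (c.reg 9)) + 1,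
          c'.mem a = write c.mem (c.reg 22 + 1) [x] a := by
        intro a ha
        have := q'.mem a (by simpa [hone, hx] using ha)
        simpa [hone, hx] using this
      refine hQ c' ⟨?_, ?_, q'.out, ?_⟩ ?_ ?_
      · intro i hi
        rw [q'.reg i hi]
        simp [show i ≠ 20 by omega, show i ≠ 21 by omega, show i ≠ 22 by omega,
          show i ≠ 23 by omega, show i ≠ 24 by omega]
      · intro a ha
        rw [hmem a (by omega), write_lt _ _ ha]
      · simp only [List.length_cons]
        omega
      · rw [e']
        by_cases hp : HasItem E x (c.reg 9)
        · simp [hone, hx, hp, bit]; omega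
        · simp [hone, hx, hp, bit]
      · by_cases hp : HasItem E x (c.reg 9)
        · rw [List.filter_cons_of_pos (by simpa using hp), holdsL_cons]
          refine ⟨?_, ?_⟩
          · rw [hmem _ (by simp [bit, hp]), write_singleton]
            simp
          · simpa [hone, hx, hp, bit] using m'
        · rw [List.filter_cons_of_neg (by simpa using hp)]
          simpa [hone, hx, hp, bit] using m'

open Classical in
theorem wp_restrict (hM : M.Basic) (hc : c.Consts) {T : Finset (Fin n)}
    (hT : Holds c.mem (c.reg 5) T) (hb : c.reg 5 + T.card + 1 ≤ c.reg 6)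
    (hu : c.reg 6 + T.card + 1 ≤ M.used) {i : Fin q} (hi : c.reg 9 = i)
    (hQ : ∀ c', Quiet 13 (c.reg 6) (8 * n + 6) c c' →
      Holds c'.mem (c.reg 6) (restrictTo E.attr T i) →
      c'.reg 13 = (restrictTo E.attr T i).card → Q c') :
    WP E M restrict c Q := by
  have hn := card_le T
  rw [holds_iff] at hT
  have hY : elems (restrictTo E.attr T i) =
      (elems T).filter fun v => HasItem E v (c.reg 9) := by
    refine (elems_filter T _ (fun v => HasItem E v (c.reg 9)) fun v => ?_)
    rw [hi, hasItem_iff]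
  refine wp_seq ?_
  refine wp_block_cons (wp_load (by omega) ?_)
  refine wp_block_cons (wp_move (by simp [hc.zero]) ?_)
  refine wp_block_cons (wp_move (by simp [hc.zero]) (wp_block_nil (wp_seq ?_)))
  refine wp_restrict_loop hM (elems T) _ ⟨?_, ?_⟩ ?_ ?_ ?_ ?_ ?_
  · simpa using hc.one
  · simpa using hc.zero
  · simpa using hT.2
  · simpa using hT.1
  · simp; omega
  · simp; omega
  · intro c₁ q₁ e₁ m₁
    have ht := q₁.time_le
    have h6 : c₁.reg 6 = c.reg 6 := by
      rw [q₁.reg 6 (by simp)]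
      simp
    simp [← hY] at ht e₁ m₁
    refine wp_block_cons (wp_sub ?_)
    refine wp_block_cons (wp_store (by simp [h6]; omega) (wp_block_nil ?_))
    refine hQ _ ⟨?_, ?_, q₁.out, ?_⟩ ?_ ?_
    · intro k hk
      have := q₁.reg k hk
      simpa [show k ≠ 20 by omega, show k ≠ 21 by omega, show k ≠ 22 by omega,
        show k ≠ 13 by omega] using this
    · intro a ha
      have := q₁.mem a (by simp; omega)
      simp only [Cfg.tick_mem, Cfg.put_mem, Cfg.set_reg, Cfg.tick_reg, h6]
      simp only [Nat.reduceEqDiff, reduceIte]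
      rw [write_lt _ _ ha]
      simpa using this
    · simp; omega
    · rw [holds_iff]
      refine ⟨by simp [h6, write_singleton, e₁], HoldsL.congr m₁ fun a ha _ => ?_⟩
      simp [h6, write_singleton, show a ≠ c.reg 6 by omega]
    · simp [h6, e₁]

theorem wp_writeUniv_loop (k : ℕ) :
    ∀ c : Cfg n, c.Consts → c.reg 20 = k → k + 1 ≤ M.used →
      (∀ c' : Cfg n, Quiet 13 1 (4 * k + 1) c c' →
        (∀ a, a < k → c'.mem (a + 1) = a) → (∀ a, k < a → c'.mem a = c.mem a) → Q c') →
      WP E M (.loop 20 (block [.sub 21 20 2, .store 20 21, .sub 20 20 2])) c Q := by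
  induction k with
  | zero =>
    intro c _ h0 _ hQ
    exact wp_loop_stop h0 (hQ _ ⟨fun _ _ => rfl, fun _ _ => rfl, rfl, by simp⟩ (by simp)
      fun _ _ => rfl)
  | succ k ih =>
    intro c hc h20 hu hQ
    have hone := hc.one
    refine wp_loop_step (by omega) ?_
    refine wp_block_cons (wp_sub ?_)
    refine wp_block_cons (wp_store (by simp; omega) ?_)
    refine wp_block_cons (wp_sub (wp_block_nil ?_))
    refine ih _ ⟨?_, ?_⟩ ?_ (by omega) ?_
    · simpa using hc.one
    · simpa using hc.zero
    · simp [h20, hone]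
    · intro c' q' m' f'
      have ht := q'.time_le
      simp at ht
      refine hQ c' ⟨?_, ?_, q'.out, by omega⟩ ?_ ?_
      · intro i hi
        rw [q'.reg i hi]
        simp [show i ≠ 20 by omega, show i ≠ 21 by omega]
      · intro a ha
        rw [q'.mem a ha]
        simp [h20, write_singleton, show a ≠ k + 1 by omega]
      · intro a ha
        rcases Nat.lt_succ_iff_lt_or_eq.1 ha with h | rfl
        · exact m' a h
        · rw [f' _ (by omega)]
          simp [h20, write_singleton, hone]
      · intro a ha
        rw [f' a (by omega)]
        simp [h20, write_singleton, show a ≠ k + 1 by omega]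

theorem wp_writeUniv (hc : c.Consts) (h0 : c.reg 0 = n) (hu : n + 1 ≤ M.used)
    (hQ : ∀ c', Quiet 13 0 (4 * n + 3) c c' → Holds c'.mem 0 (Finset.univ : Finset (Fin n)) →
      Q c') : WP E M writeUniv c Q := by
  refine wp_seq ?_
  refine wp_block_cons (wp_store (by simp [hc.zero]; omega) ?_)
  refine wp_block_cons (wp_move (by simp [hc.zero]) (wp_block_nil ?_))
  refine wp_writeUniv_loop n _ ⟨?_, ?_⟩ ?_ hu ?_
  · simpa using hc.one
  · simpa using hc.zero
  · simpa using h0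
  · intro c' q' m' f'
    have ht := q'.time_le
    simp at ht
    refine hQ c' ⟨?_, by simp, q'.out, by omega⟩ ?_
    · intro i hi
      rw [q'.reg i hi]
      simp [show i ≠ 20 by omega]
    · rw [holds_iff, elems_univ]
      refine ⟨?_, fun k hk => ?_⟩
      · rw [q'.mem 0 (by simp)]
        simp [hc.zero, h0, write_singleton]
      · rw [List.length_range] at hk
        simpa [add_comm] using m' k hk

end

/-! ### Steps of the search -/

section
variable {n q : ℕ} {E : Env n q} {M : Lim} {c : Cfg n} {Q : Cfg n → Prop}

/-- The limits suffice for the auxiliary quantities of the search. -/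
structure Lim.Adequate (M : Lim) (E : Env n q) : Prop extends M.Basic where
  card_mul_card : n * n ≤ M.word
  depth_mul_item : (n + 2) * q ≤ M.word
  depth : n + 2 ≤ M.word
  space₂ : E.space₂ ≤ M.work
  spacePos : E.spacePos ≤ M.work

/-- The search is at the set `T`, stored at the address `a`: the memory is free from `b` on, the
depth is `d`, its parity `p`, the items below `j` have been dealt with except for the `r`
candidates still waiting. -/
structure Node (c : Cfg n) (q : ℕ) (T : Finset (Fin n)) (a b d p j r : ℕ) : Prop
    extends c.Consts where
  items : c.reg 1 = q
  addr : c.reg 5 = a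
  base : c.reg 6 = b
  depth : c.reg 7 = d
  parity : c.reg 8 = p
  item : c.reg 9 = j
  rem : c.reg 10 = r
  holds : Holds c.mem a T
  below : a + T.card + 1 ≤ b

/-- The candidates still waiting are the sets of the list `L`, stored from the address `reg 11` on
between the addresses `b` and `e`. -/
structure Waiting (c : Cfg n) (b e : ℕ) (L : List (Finset (Fin n))) : Prop where
  base_le : b ≤ c.reg 11
  holds : HoldsL c.mem (c.reg 11) (encodeList L)
  le_end : c.reg 11 + (encodeList L).length ≤ e
  end_eq : c.reg 12 = e

theorem Node.tick {T : Finset (Fin n)} {a b d p j r t : ℕ} (h : Node c q T a b d p j r) :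
    Node (c.tick t) q T a b d p j r :=
  ⟨⟨h.one, h.zero⟩, h.items, h.addr, h.base, h.depth, h.parity, h.item, h.rem, h.holds, h.below⟩

theorem Waiting.tick {b e t : ℕ} {L : List (Finset (Fin n))} (h : Waiting c b e L) :
    Waiting (c.tick t) b e L := ⟨h.base_le, h.holds, h.le_end, h.end_eq⟩

/-- The five words saved at the address `e` by a descent. -/
structure Saved (m : ℕ → ℕ) (e a j r x b : ℕ) : Prop where
  addr : m e = a
  item : m (e + 1) = j
  rem : m (e + 2) = r
  next : m (e + 3) = x
  base : m (e + 4) = b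

/-- The outcome `c'` of a piece of program started in `c` that writes nothing below the address
`b`, outputs the sets of `l` at some moments in between, and takes at most `t` units of time. -/
structure Emits (b t : ℕ) (l : List (Finset (Fin n))) (c c' : Cfg n) : Prop where
  mem : ∀ k < b, c'.mem k = c.mem k
  time_le : c'.time ≤ c.time + t
  out : ∃ o : List (Finset (Fin n) × ℕ), c'.out = c.out ++ o ∧ o.map Prod.fst = l ∧
    ∀ x ∈ o, c.time ≤ x.2 ∧ x.2 ≤ c'.time

open Classical in
/-- The step to the next item either finds no candidates, since no element or every element of the
current set has the item, or ends with the list of the maximal components inside. -/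
theorem wp_nextItem (hM : M.Adequate E) {T : Finset (Fin n)} {a b d p : ℕ} {i : Fin q}
    (hc : Node c q T a b d p i 0) (hd : 2 ≤ d) (hdn : d ≤ n + 2)
    (hb : b + (n + 1) ≤ M.used) (hb' : b + E.space₂ ≤ M.used)
    (hlen : ∀ Y : Finset (Fin n), Y.Nonempty → (encodeList (E.L₂ Y)).length ≤ E.space₂)
    {δ : ℕ} (hcount : ∀ Y : Finset (Fin n), Y.Nonempty → (E.L₂ Y).length ≤ δ)
    (hskip : ∀ c', Emits b (E.time₂ + 8 * n + 5 * δ + 39) [] c c' →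
      Node c' q T a b d p (i + 1) 0 →
      restrictTo E.attr T i = ∅ ∨ restrictTo E.attr T i = T → Q c')
    (hcall : ∀ c', Emits b (E.time₂ + 8 * n + 5 * δ + 39) [] c c' →
      Node c' q T a b d p (i + 1) (E.L₂ (restrictTo E.attr T i)).length →
      Waiting c' b (b + (encodeList (E.L₂ (restrictTo E.attr T i))).length)
        (E.L₂ (restrictTo E.attr T i)) →
      (restrictTo E.attr T i).Nonempty → restrictTo E.attr T i ≠ T → Q c') :
    WP E M searchStep c Q := by
  have h1 := hM.one_le
  have h2 := hM.used_le
  have hTn := card_le T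
  have hi := i.2
  have hab := hc.below
  set Y := restrictTo E.attr T i with hYdef
  have hYT : Y ⊆ T := Finset.filter_subset _ _
  have hYc := Finset.card_le_card hYT
  refine wp_branch (fun h => absurd hc.rem h) fun _ => ?_
  refine wp_seq (wp_block_cons (wp_sub ?_))
  refine wp_block_cons (wp_sub ?_)
  refine wp_block_cons (wp_mul ?_ (wp_block_nil ?_))
  · simp only [Cfg.set_reg, Cfg.tick_reg, Nat.reduceEqDiff, reduceIte, hc.depth, hc.one, hc.items,
      hc.item]
    refine le_trans (Nat.mul_le_mul ?_ ?_) hM.depth_mul_item <;> omega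
  refine wp_branch (fun _ => ?_) (fun h => ?_)
  swap
  · simp [hc.depth, hc.one, hc.items, hc.item] at h
    omega
  refine wp_seq (wp_restrict hM.toBasic (T := T) (i := i) ⟨?_, ?_⟩ ?_ ?_ ?_ ?_ ?_)
  · simpa using hc.one
  · simpa using hc.zero
  · simpa [hc.addr] using hc.holds
  · simpa [hc.addr, hc.base] using hc.below
  · simp [hc.base]; omega
  · simpa using hc.item
  intro c₁ q₁ hY h13
  have ht := q₁.time_le
  have r₁ : ∀ k < 13, c₁.reg k = c.reg k := by
    intro k hk
    rw [q₁.reg k hk]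
    simp [show k ≠ 13 by omega, show k ≠ 14 by omega]
  have m₁ : ∀ k < b, c₁.mem k = c.mem k := by
    intro k hk
    exact q₁.mem k (by simpa [hc.base] using hk)
  have o₁ : c₁.out = c.out := q₁.out
  have hT₁ : Holds c₁.mem a T := hc.holds.congr hc.below m₁
  have hTa : c₁.mem a = T.card := (holds_iff.1 hT₁).1
  simp only [Cfg.set_reg, Cfg.tick_reg, Nat.reduceEqDiff, reduceIte, hc.base, ← hYdef] at hY h13
  simp only [Cfg.set_time, Cfg.tick_time] at ht
  have h13' : c₁.reg 13 = Y.card := h13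
  have a₁ : c₁.reg 5 = a := (r₁ 5 (by simp)).trans hc.addr
  have j₁ : c₁.reg 9 = i := (r₁ 9 (by simp)).trans hc.item
  have one₁ : c₁.reg 2 = 1 := (r₁ 2 (by simp)).trans hc.one
  have zero₁ : c₁.reg 3 = 0 := (r₁ 3 (by simp)).trans hc.zero
  have b₁ : c₁.reg 6 = b := (r₁ 6 (by simp)).trans hc.base
  have hqw : q ≤ M.word := le_trans (Nat.le_mul_of_pos_left q (by omega)) hM.depth_mul_item
  refine wp_seq (wp_block_cons (wp_add (by simp [j₁, one₁]; omega) ?_))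
  refine wp_block_cons (wp_load (by simp [a₁]; omega) ?_)
  refine wp_block_cons (wp_sub ?_)
  refine wp_block_cons (wp_mul ?_ (wp_block_nil ?_))
  · simp only [Cfg.set_reg, Cfg.tick_reg, Cfg.set_mem, Cfg.tick_mem, Nat.reduceEqDiff, reduceIte,
      a₁, hTa, h13']
    refine le_trans (Nat.mul_le_mul ?_ ?_) hM.card_mul_card <;> omega
  refine wp_branch (fun hne => ?_) (fun h0 => wp_skip ?_)
  · simp only [Cfg.set_reg, Cfg.tick_reg, Cfg.set_mem, Cfg.tick_mem, Nat.reduceEqDiff, reduceIte,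
      a₁, hTa, h13', Nat.mul_ne_zero_iff] at hne
    have hYne : Y.Nonempty := Finset.card_pos.1 (Nat.pos_of_ne_zero hne.2)
    have hYT' : Y ≠ T := by
      intro h
      rw [h] at hne
      omega
    have hl := hlen Y hYne
    have hcnt := hcount Y hYne
    have hLl := length_le_length_encodeList (E.L₂ Y)
    refine wp_seq (wp_block_cons (wp_call₂ (Y := Y) (by simpa [b₁] using hY) hYne
      (by simp [b₁]; omega) hM.space₂ (by simp [b₁]; omega)
      (fun x hx => (le_of_mem_encodeList hx).trans (by have := hM.depth; omega))
      (by omega) ?_))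
    refine wp_block_cons (wp_move (by simp [zero₁]) (wp_block_nil ?_))
    refine wp_listEnd hM.toBasic (b := b) (L := E.L₂ Y) ⟨?_, ?_⟩ ?_ ?_ ?_ ?_
    · simpa using one₁
    · simpa using zero₁
    · simpa [b₁] using HoldsL.write _ _ _
    · simp
    · simp [b₁]; omega
    intro c₂ q₂ m₂ e₂
    have ht₂ := q₂.time_le
    simp at ht₂
    have r₂ : ∀ k < 9, c₂.reg k = c.reg k := by
      intro k hk
      rw [q₂.reg k (by omega)]
      simp [show k ≠ 9 by omega, show k ≠ 14 by omega, show k ≠ 10 by omega,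
        show k ≠ 11 by omega, r₁ k (by omega)]
    have hm₂ : ∀ k < b, c₂.mem k = c.mem k := by
      intro k hk
      rw [m₂]
      simp [b₁, write_lt _ _ hk, m₁ k hk]
    have h11 : c₂.reg 11 = b := by
      rw [q₂.reg 11 (by simp)]
      simp [b₁]
    refine hcall c₂ ⟨hm₂, by omega, [], ?_, rfl, by simp⟩
      ⟨⟨?_, ?_⟩, ?_, ?_, ?_, ?_, ?_, ?_, ?_, ?_, hc.below⟩ ⟨?_, ?_, ?_, ?_⟩ hYne hYT'
    · rw [List.append_nil]
      exact q₂.out.trans o₁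
    · exact (r₂ 2 (by simp)).trans hc.one
    · exact (r₂ 3 (by simp)).trans hc.zero
    · exact (r₂ 1 (by simp)).trans hc.items
    · exact (r₂ 5 (by simp)).trans hc.addr
    · exact (r₂ 6 (by simp)).trans hc.base
    · exact (r₂ 7 (by simp)).trans hc.depth
    · exact (r₂ 8 (by simp)).trans hc.parity
    · rw [q₂.reg 9 (by simp)]
      simp [j₁, one₁]
    · rw [q₂.reg 10 (by simp)]
      simp
    · exact hc.holds.congr hc.below hm₂
    · omega
    · rw [h11, m₂]
      simpa [b₁] using HoldsL.write _ _ _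
    · rw [h11]
    · rw [e₂]
      simp [b₁]
  · simp only [Cfg.set_reg, Cfg.tick_reg, Cfg.set_mem, Cfg.tick_mem, Nat.reduceEqDiff, reduceIte,
      a₁, hTa, h13', Nat.mul_eq_zero] at h0
    refine hskip _ ⟨m₁, by simp; omega, [], by simpa using o₁, rfl, by simp⟩
      ⟨⟨?_, ?_⟩, ?_, ?_, ?_, ?_, ?_, ?_, ?_, hT₁, hc.below⟩ ?_
    · simpa using one₁
    · simpa using zero₁
    · simpa [r₁] using hc.items
    · simpa using a₁
    · simpa using b₁
    · simpa [r₁] using hc.depth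
    · simpa [r₁] using hc.parity
    · simp [j₁, one₁]
    · simpa [r₁] using hc.rem
    · rcases h0 with h0 | h0
      · exact Or.inr (Finset.eq_of_subset_of_card_le hYT (by omega))
      · exact Or.inl (Finset.card_eq_zero.1 h0)

theorem wp_push (hM : M.Adequate E) {T Z : Finset (Fin n)} {L : List (Finset (Fin n))}
    {a b d p j e z : ℕ} (hc : Node c q T a b d p j L.length) (hw : Waiting c b e L)
    (hz : c.reg 14 = z) (hZ : Holds c.mem z Z) (hze : z + Z.card + 1 ≤ e)
    (he : e + 5 ≤ M.used) (hd : d + 1 ≤ n + 2) (hp : p ≤ 1)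
    (hQ : ∀ c' x, Emits e (n + 18) (if p = 1 then [Z] else []) c c' →
      Node c' q Z z (e + 5) (d + 1) (1 - p) j 0 → Saved c'.mem e a j L.length x b →
      HoldsL c'.mem x (encodeList L) → b ≤ x → x + (encodeList L).length ≤ e → Q c') :
    WP E M push c Q := by
  have h1 := hM.one_le
  have h2 := hM.used_le
  have h3 := hM.depth
  have hZn := card_le Z
  have hab := hc.below
  have h12 := hw.end_eq
  have hone := hc.one
  refine wp_seq ?_
  refine wp_block_store e a h12 hc.addr (by omega) ?_
  refine wp_block_add e 1 (by simpa using h12) (by simpa using hone) (by omega) ?_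
  refine wp_block_store (e + 1) j (by simp) (by simpa using hc.item) (by omega) ?_
  refine wp_block_add (e + 1) 1 (by simp) (by simpa using hone) (by omega) ?_
  refine wp_block_store (e + 2) L.length (by simp) (by simpa using hc.rem) (by omega) ?_
  refine wp_block_add (e + 2) 1 (by simp) (by simpa using hone) (by omega) ?_
  refine wp_block_store (e + 3) (c.reg 11) (by simp) (by simp) (by omega) ?_
  refine wp_block_add (e + 3) 1 (by simp) (by simpa using hone) (by omega) ?_
  refine wp_block_store (e + 4) b (by simp) (by simpa using hc.base) (by omega) ?_
  refine wp_block_add (e + 4) 1 (by simp) (by simpa using hone) (by omega) ?_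
  refine wp_block_add (e + 5) 0 (by simp) (by simpa using hc.zero) (by omega) ?_
  refine wp_block_add z 0 (by simpa using hz) (by simpa using hc.zero) (by omega) ?_
  refine wp_block_cons (wp_const (by omega) ?_)
  refine wp_block_sub 1 p (by simpa using hone) (by simpa using hc.parity) ?_
  refine wp_block_add d 1 (by simpa using hc.depth) (by simpa using hone) (by omega)
    (wp_block_nil' fun c₁ hc₁ => ?_)
  have m₁ : ∀ k < e, c₁.mem k = c.mem k := by
    intro k hk
    rw [hc₁]
    simp [write_singleton, show k ≠ e by omega, show k ≠ e + 1 by omega,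
      show k ≠ e + 2 by omega, show k ≠ e + 3 by omega, show k ≠ e + 4 by omega]
  have hs : Saved c₁.mem e a j L.length (c.reg 11) b := by
    rw [hc₁]
    constructor <;>
    simp [write_singleton]
  have hn : Node c₁ q Z z (e + 5) (d + 1) (1 - p) j 0 := by
    refine ⟨⟨?_, ?_⟩, ?_, ?_, ?_, ?_, ?_, ?_, ?_, hZ.congr hze m₁, by omega⟩ <;> rw [hc₁]
    · simpa using hone
    · simpa using hc.zero
    · simpa using hc.items
    · simp
    · simp
    · simp
    · simp
    · simpa using hc.item
    · simp
  have t₁ : c₁.time = c.time + 15 := by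
    rw [hc₁]; rfl
  have o₁ : c₁.out = c.out := by
    rw [hc₁]; rfl
  have hl : HoldsL c₁.mem (c.reg 11) (encodeList L) :=
    hw.holds.congr fun k _ hk => m₁ k (by have := hw.le_end; omega)
  clear hc₁
  refine wp_branch (fun h => wp_skip ?_) (fun h => ?_)
  · have hp0 : p = 0 := by
      rw [hn.parity] at h
      omega
    refine hQ _ (c.reg 11) ⟨m₁, ?_, [], ?_, ?_, ?_⟩ hn.tick hs hl hw.base_le hw.le_end
    · simp [t₁]
    · simpa using o₁
    · simp [hp0]
    · simp
  · have hp1 : p = 1 := by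
      rw [hn.parity] at h
      omega
    refine wp_block_cons (wp_output (X := Z) ?_ ?_ (wp_block_nil ?_))
    · simpa [hn.addr] using hn.holds
    · simp [hn.addr]; omega
    refine hQ _ (c.reg 11) ⟨m₁, ?_, [(Z, _)], congrArg (· ++ _) o₁, ?_, ?_⟩
      ⟨⟨hn.one, hn.zero⟩, hn.items, hn.addr, hn.base, hn.depth, hn.parity, hn.item, hn.rem,
      hn.holds, hn.below⟩ hs hl hw.base_le hw.le_end
    · simp [t₁]; omega
    · simp [hp1]
    · simp [t₁]; omega

/-- The step to the next candidate either drops it or descends to it. -/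
theorem wp_candidate (hM : M.Adequate E) {ρ : Finset (Fin n) → ℝ}
    (hpos : ∀ X, E.pos X ↔ 0 < ρ X) {T Z : Finset (Fin n)} {L : List (Finset (Fin n))}
    {a b d p j e : ℕ} (hc : Node c q T a b d p j (L.length + 1)) (hw : Waiting c b e (Z :: L))
    (hj : j ≤ q) (he : e + 5 ≤ M.used) (hd : d + 1 ≤ n + 2) (hp : p ≤ 1)
    (hreject : ∀ c', Emits b (E.timePos + q * (12 * n + 14) + n + 39) [] c c' →
      Node c' q T a b d p j L.length → Waiting c' b e L →
      ¬ Accepted E.attr ρ T (j - 1) Z → Q c')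
    (haccept : ∀ c' z x, Emits e (E.timePos + q * (12 * n + 14) + n + 39)
        (if p = 1 then [Z] else []) c c' →
      Node c' q Z z (e + 5) (d + 1) (1 - p) j 0 → Saved c'.mem e a j L.length x b →
      HoldsL c'.mem x (encodeList L) → b ≤ x → x + (encodeList L).length ≤ e →
      Accepted E.attr ρ T (j - 1) Z → Q c') :
    WP E M searchStep c Q := by
  classical
  have h1 := hM.one_le
  have h2 := hM.used_le
  have hab := hc.below
  have hle := hw.le_end
  have hbl := hw.base_le
  have hh := hw.holds
  rw [encodeList_cons, holdsL_append, length_encode] at hh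
  rw [encodeList_cons, List.length_append, length_encode] at hle
  have hZ : Holds c.mem (c.reg 11) Z := hh.1
  refine wp_branch (fun _ => ?_) fun h => absurd (hc.rem.symm.trans h) (by omega)
  refine wp_seq (wp_time_le (wp_prefixTest hM.toBasic (b := e) (X := Z) (T := T) ⟨hc.one, hc.zero⟩ hZ ?_
    ?_ ?_ ?_ ?_))
  · simpa [hc.addr] using hc.holds
  · simp; omega
  · simp [hc.addr]; omega
  · simpa [hc.item] using hj
  intro c₁ q₁ m₁ e₁ hmono
  replace m₁ : c₁.mem = c.mem := m₁
  have r₁ : ∀ k < 20, c₁.reg k = c.reg k := q₁.reg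
  have ht := q₁.time_le
  simp only [Cfg.tick_time, Cfg.tick_reg, hc.item] at ht e₁ hmono
  have hZ₁ : Holds c₁.mem (c.reg 11) Z := m₁ ▸ hZ
  have hZa : c₁.mem (c.reg 11) = Z.card := (holds_iff.1 hZ₁).1
  have hacc : bit (E.pos Z) * c₁.reg 20 = bit (Accepted E.attr ρ T (j - 1) Z) := by
    rw [e₁, bit_mul, hpos]
    rfl
  refine wp_seq (wp_block_cons (wp_test (X := Z) ?_ ?_ hM.spacePos h1 ?_))
  · simpa [r₁] using hZ₁
  · simp [r₁]; omega
  refine wp_block_cons (wp_mul ?_ ?_)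
  · simp only [Cfg.set_reg, Cfg.tick_reg, Nat.reduceEqDiff, reduceIte, hacc]
    exact (bit_le_one _).trans h1
  refine wp_block_cons (wp_move (by simp [r₁, hc.zero]) ?_)
  refine wp_block_cons (wp_load (by simp [r₁]; omega) ?_)
  refine wp_block_cons (wp_add (by simp [r₁, hZa]; omega) ?_)
  refine wp_block_cons (wp_add (by simp [r₁, hZa, hc.one]; omega) ?_)
  refine wp_block_cons (wp_sub (wp_block_nil' fun c₂ hc₂ => ?_))
  have t₂ : c₂.time = c₁.time + (E.timePos + 7) := by
    rw [hc₂]; simp; ring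
  have o₂ : c₂.out = c.out := by
    rw [hc₂]; exact q₁.out
  have m₂ : c₂.mem = c.mem := by
    rw [hc₂]; exact m₁
  have h13 : c₂.reg 13 = bit (Accepted E.attr ρ T (j - 1) Z) := by
    rw [hc₂, ← hacc]; simp
  have h14 : c₂.reg 14 = c.reg 11 := by
    rw [hc₂]; simp [r₁]
  have h11 : c₂.reg 11 = c.reg 11 + (Z.card + 1) := by
    rw [hc₂]; simp [r₁, hZa, hc.one, add_assoc]
  have hn : Node c₂ q T a b d p j L.length := by
    refine ⟨⟨?_, ?_⟩, ?_, ?_, ?_, ?_, ?_, ?_, ?_, m₂ ▸ hc.holds, hc.below⟩ <;> rw [hc₂]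
    · simp [r₁, hc.one]
    · simp [r₁, hc.zero]
    · simp [r₁, hc.items]
    · simp [r₁, hc.addr]
    · simp [r₁, hc.base]
    · simp [r₁, hc.depth]
    · simp [r₁, hc.parity]
    · simp [r₁, hc.item]
    · simp [r₁, hc.rem, hc.one]
  have hw₂ : Waiting c₂ b e L := by
    refine ⟨by omega, by rw [m₂, h11]; exact hh.2, by omega, ?_⟩
    rw [hc₂, ← hw.end_eq]; simp [r₁]
  clear hc₂
  refine wp_branch (fun h => ?_) (fun h => wp_skip ?_)
  · have hA : Accepted E.attr ρ T (j - 1) Z := by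
      rw [h13] at h
      by_contra hA
      exact h (bit_eq_zero.2 hA)
    refine wp_push hM (c := c₂.tick 1) (T := T) (Z := Z) (L := L) (a := a) (b := b) (d := d)
      (p := p) (j := j) (e := e) (z := c.reg 11)
      hn.tick hw₂.tick h14
      (by rw [Cfg.tick_mem, m₂]; exact hZ) (by omega) he hd hp ?_
    intro c' x em nd sv hl hbx hxe
    obtain ⟨o, ho, hol, hot⟩ := em.out
    have ht' := em.time_le
    simp only [Cfg.tick_time, Cfg.tick_out] at ht' ho hot
    refine haccept c' (c.reg 11) x ⟨fun k hk => ?_, by omega, o, by rw [ho, o₂], hol,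
      fun y hy => ?_⟩ nd sv hl hbx hxe hA
    · rw [em.mem k hk, Cfg.tick_mem, m₂]
    · have := hot y hy
      omega
  · refine hreject _ ⟨fun k _ => by rw [Cfg.tick_mem, m₂], by simp; omega, [], by simpa using o₂,
      rfl, by simp⟩ hn.tick hw₂.tick ?_
    rw [h13] at h
    exact bit_eq_zero.1 h

/-- The step that returns from `Z`, when no item is left or the depth becomes zero. The saved words
may be arbitrary, so that this also covers the return from the ground set. -/
theorem wp_pop (hM : M.Adequate E) {Z : Finset (Fin n)} {a b d p j e z j' r x : ℕ}
    (hc : Node c q Z z (e + 5) (d + 1) p j' 0) (hs : Saved c.mem e a j r x b)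
    (he : e + 5 ≤ M.used) (hj : d * (q - j') = 0)
    (hQ : ∀ c', Emits e (n + 20) (if p = 0 then [] else [Z]) c c' → c'.mem = c.mem →
      c'.Consts → c'.reg 1 = q → c'.reg 5 = a → c'.reg 6 = b → c'.reg 7 = d →
      c'.reg 8 = 1 - p → c'.reg 9 = j → c'.reg 10 = r → c'.reg 11 = x → c'.reg 12 = e → Q c') :
    WP E M searchStep c Q := by
  have h1 := hM.one_le
  have h2 := hM.used_le
  have hone := hc.one
  have hZn := card_le Z
  have hb := hc.below
  refine wp_branch (fun h => absurd hc.rem h) fun _ => ?_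
  refine wp_seq (wp_block_cons (wp_sub ?_))
  refine wp_block_cons (wp_sub ?_)
  refine wp_block_cons (wp_mul ?_ (wp_block_nil' fun c₁ hc₁ => ?_))
  · simp [hc.depth, hc.one, hc.items, hc.item, hj]
  have m₁ : c₁.mem = c.mem := by rw [hc₁]; rfl
  have t₁ : c₁.time = c.time + 4 := by rw [hc₁]; rfl
  have o₁ : c₁.out = c.out := by rw [hc₁]; rfl
  have r₁ : ∀ k < 13, c₁.reg k = c.reg k := by
    intro k hk
    rw [hc₁]
    simp [show k ≠ 13 by omega, show k ≠ 14 by omega]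
  have h₁ : c₁.reg 13 = 0 := by simp [hc₁, hc.depth, hc.one, hc.items, hc.item, hj]
  clear hc₁
  refine wp_branch (fun h => absurd h₁ h) (fun _ => ?_)
  -- the restoration, from the configuration reached after the output that may precede it
  have key : ∀ c₂ : Cfg n, c₂.reg = c₁.reg → c₂.mem = c₁.mem → c₂.time ≤ c.time + (n + 8) →
      (∃ o : List (Finset (Fin n) × ℕ), c₂.out = c.out ++ o ∧
        o.map Prod.fst = (if p = 0 then [] else [Z]) ∧ ∀ y ∈ o, c.time ≤ y.2 ∧ y.2 ≤ c₂.time) →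
      WP E M (block [.sub 12 6 2, .load 6 12, .sub 12 12 2, .load 11 12, .sub 12 12 2, .load 10 12,
      .sub 12 12 2, .load 9 12, .sub 12 12 2, .load 5 12, .sub 8 2 8, .sub 7 7 2]) c₂ Q := by
    intro c₂ hr hm ht ⟨o, ho, hol, hot⟩
    have hb₂ : c₂.reg 6 = e + 5 := by rw [hr, r₁ 6 (by simp), hc.base]
    have one₂ : c₂.reg 2 = 1 := by rw [hr, r₁ 2 (by simp), hc.one]
    have s₂ : Saved c₂.mem e a j r x b := by rw [hm, m₁]; exact hs
    have par₂ : c₂.reg 8 = p := by rw [hr, r₁ 8 (by simp), hc.parity]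
    have dep₂ : c₂.reg 7 = d + 1 := by rw [hr, r₁ 7 (by simp), hc.depth]
    refine wp_block_sub (e + 5) 1 hb₂ one₂ ?_
    refine wp_block_load (e + 4) b (by simp) s₂.base (by omega) ?_
    refine wp_block_sub (e + 4) 1 (by simp) (by simpa using one₂) ?_
    refine wp_block_load (e + 3) x (by simp) s₂.next (by omega) ?_
    refine wp_block_sub (e + 3) 1 (by simp) (by simpa using one₂) ?_
    refine wp_block_load (e + 2) r (by simp) s₂.rem (by omega) ?_
    refine wp_block_sub (e + 2) 1 (by simp) (by simpa using one₂) ?_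
    refine wp_block_load (e + 1) j (by simp) s₂.item (by omega) ?_
    refine wp_block_sub (e + 1) 1 (by simp) (by simpa using one₂) ?_
    refine wp_block_load e a (by simp) s₂.addr (by omega) ?_
    refine wp_block_sub 1 p (by simpa using one₂) (by simpa using par₂) ?_
    refine wp_block_sub (d + 1) 1 (by simpa using dep₂) (by simpa using one₂) (wp_block_nil ?_)
    refine hQ _ ⟨?_, ?_, o, ho, hol, ?_⟩ ?_ ⟨?_, ?_⟩ ?_ ?_ ?_ ?_ ?_ ?_ ?_ ?_ ?_
    · intro k _
      simp [hm, m₁]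
    · simp; omega
    · intro y hy
      have := hot y hy
      simp; omega
    · simp [hm, m₁]
    · simpa using one₂
    · simp [hr, r₁, hc.zero]
    · simp [hr, r₁, hc.items]
    all_goals simp
  have hz : c₁.reg 5 = z := (r₁ 5 (by simp)).trans hc.addr
  have hp : c₁.reg 8 = p := (r₁ 8 (by simp)).trans hc.parity
  refine wp_seq (wp_branch (fun h => ?_) (fun h => wp_skip ?_))
  · rw [Cfg.tick_reg, hp] at h
    refine wp_block_cons (wp_output (X := Z) ?_ ?_ (wp_block_nil ?_))
    · simpa [hz, m₁] using hc.holds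
    · simp [hz]; omega
    · refine key _ rfl rfl (by simp [t₁]; omega) ⟨[(Z, _)], congrArg (· ++ _) o₁, ?_, ?_⟩
      · simp [h]
      · simp [t₁]; omega
  · rw [Cfg.tick_reg, hp] at h
    exact key _ rfl rfl (by simp [t₁]; omega) ⟨[], by simpa using o₁, by simp [h], by simp⟩

end

/-! ### Delay and correctness of the search -/

section Delay
variable {n : ℕ}

/-- No two consecutive outputs are more than `G` apart, and the last output (or the start) is at
most `x` ago. -/
structure Slack (G x : ℕ) (c : Cfg n) : Prop where
  chain : (0 :: c.out.map Prod.snd).IsChain fun t t' => t' ≤ t + G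
  last : ∀ t ∈ (0 :: c.out.map Prod.snd).getLast?, c.time ≤ t + x

theorem Slack.mono {G x x' : ℕ} {c : Cfg n} (h : Slack G x c) (hx : x ≤ x') : Slack G x' c :=
  ⟨h.chain, fun t ht => (h.last t ht).trans (by omega)⟩

theorem Emits.of_tick {b t k : ℕ} {l : List (Finset (Fin n))} {c c' : Cfg n}
    (h : Emits b t l (c.tick k) c') : Emits b (t + k) l c c' := by
  obtain ⟨o, ho, hl, ht⟩ := h.out
  have h1 := h.time_le
  simp only [Cfg.tick_time] at h1 ht
  exact ⟨h.mem, by omega, o, ho, hl, fun y hy => ⟨by have := ht y hy; omega, (ht y hy).2⟩⟩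

theorem Slack.of_emits_nil {G x b t : ℕ} {c c' : Cfg n} (h : Slack G x c)
    (he : Emits b t [] c c') : Slack G (x + t) c' := by
  obtain ⟨o, ho, hl, -⟩ := he.out
  obtain rfl := List.map_eq_nil_iff.1 hl
  rw [List.append_nil] at ho
  refine ⟨ho ▸ h.chain, fun s hs => ?_⟩
  rw [ho] at hs
  have := h.last s hs
  have := he.time_le
  omega

theorem Slack.of_emits_singleton {G x b t : ℕ} {c c' : Cfg n} {Z : Finset (Fin n)}
    (h : Slack G x c) (he : Emits b t [Z] c c') (hG : x + t ≤ G) : Slack G t c' := by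
  obtain ⟨o, ho, hl, hot⟩ := he.out
  obtain ⟨y, rfl, -⟩ := List.map_eq_singleton_iff.1 hl
  have hy := hot y (by simp)
  have ht := he.time_le
  have hout : 0 :: c'.out.map Prod.snd = (0 :: c.out.map Prod.snd) ++ [y.2] := by simp [ho]
  constructor
  · rw [hout, List.isChain_append]
    refine ⟨h.chain, List.isChain_singleton _, fun s hs s' hs' => ?_⟩
    have := h.last s hs
    simp at hs'
    omega
  · intro s hs
    rw [hout, List.getLast?_concat, Option.mem_some_iff] at hs
    omega

end Delay

section Search
variable {n q : ℕ}

/-- A transitive system with a volume function and an oracle for maximal components, as far as the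
search depends on them; `δ` bounds the lengths of the answers. -/
structure Instance (E : Env n q) (C : Finset (Finset (Fin n))) (ρ : Finset (Fin n) → ℝ)
    (δ : ℕ) : Prop where
  trans : IsTransitive C
  mono : ∀ X Y : Finset (Fin n), X ⊆ Y → ρ X ≤ ρ Y
  empty : ∅ ∈ C → ρ ∅ ≤ 0
  pos : ∀ X, E.pos X ↔ 0 < ρ X
  nodup : ∀ Y : Finset (Fin n), Y.Nonempty → (E.L₂ Y).Nodup
  mem : ∀ Y : Finset (Fin n), Y.Nonempty → ∀ Z, Z ∈ E.L₂ Y ↔ Z ∈ maxIn C Y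
  length_le : ∀ Y : Finset (Fin n), Y.Nonempty → (encodeList (E.L₂ Y)).length ≤ E.space₂
  count_le : ∀ Y : Finset (Fin n), Y.Nonempty → (E.L₂ Y).length ≤ δ

/-- Time bound for one candidate. -/
def candCost (E : Env n q) : ℕ := E.timePos + q * (12 * n + 14) + n + 40

/-- Time bound for one item, candidates included. -/
def itemCost (E : Env n q) (δ : ℕ) : ℕ := (E.time₂ + 8 * n + 5 * δ + 40) + δ * candCost E

/-- Time bound for all items of one set, the subtrees below its children excluded. -/
def nodeCost (E : Env n q) (δ : ℕ) : ℕ := q * itemCost E δ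

/-- Bound on the time since the last output while the search is at a set of parity `p`. The sets
of parity 0 are output before their subtrees and those of parity 1 after them, so that from one
output to the next the search spends time at only a few sets. A set of parity 1 inherits the time spent at its
parent before the descent, and the time left over by its children of parity 0; hence the larger
bound. -/
def slackBound (E : Env n q) (δ p : ℕ) : ℕ :=
  if p = 0 then 2 * nodeCost E δ + (n + 21) else 4 * nodeCost E δ + 3 * (n + 21)

/-- Bound on the time between two outputs. -/
def gapBound (E : Env n q) (δ : ℕ) : ℕ := 5 * nodeCost E δ + 5 * (n + 21)

/-- Bound on the memory that one level of the search occupies. -/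
def frameSize (E : Env n q) : ℕ := E.space₂ + n + 6

/-- The search through all items of any set `T` with at most `N` elements outputs the proper
descendants of `T`. -/
def Searches (E : Env n q) (M : Lim) (C : Finset (Finset (Fin n))) (ρ : Finset (Fin n) → ℝ)
    (δ N : ℕ) : Prop :=
  ∀ (Q : Cfg n → Prop) (T : Finset (Fin n)) (c : Cfg n) (a b d p j x : ℕ),
    T.card ≤ N → IsSolution C E.attr T → 0 < ρ T → Node c q T a b d p j 0 →
    2 ≤ d → d + T.card ≤ n + 2 → b + (T.card + 1) * frameSize E ≤ M.used → p ≤ 1 → j ≤ q →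
    Slack (gapBound E δ) x c → x + (q - j) * itemCost E δ ≤ slackBound E δ p →
    (∀ c' o, Node c' q T a b d p q 0 → (∀ k < b, c'.mem k = c.mem k) → c'.out = c.out ++ o →
      Lists (o.map Prod.fst) (ProperDesc C E.attr ρ T j) →
      Slack (gapBound E δ) (slackBound E δ p) c' → WP E M search c' Q) →
    WP E M search c Q

variable {E : Env n q} {M : Lim} {C : Finset (Finset (Fin n))} {ρ : Finset (Fin n) → ℝ} {δ : ℕ}

/-- The search through a list of candidates. Here `y` is the time that is reserved for what
remains to be done at the current set after the list. -/
theorem wp_search_list (hM : M.Adequate E) (hI : Instance E C ρ δ) {Q : Cfg n → Prop} {N : ℕ}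
    (hS : Searches E M C ρ δ N) {T : Finset (Fin n)} {a b d p j e y : ℕ} (hd : 1 ≤ d)
    (hdN : d + 1 + N ≤ n + 2) (he : e + 5 + (N + 1) * frameSize E ≤ M.used) (hj : j ≤ q)
    (hp : p ≤ 1) (L : List (Finset (Fin n))) :
    ∀ (c : Cfg n) (x : ℕ), Node c q T a b d p j L.length → Waiting c b e L →
      (∀ Z ∈ L, IsSolution C E.attr Z ∧ Z.card ≤ N) → L.Nodup →
      (∀ Z ∈ L, ∀ Z' ∈ L, Z ≠ Z' → Disjoint (Desc C E.attr ρ Z j) (Desc C E.attr ρ Z' j)) →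
      y + L.length * candCost E ≤ nodeCost E δ →
      candCost E ≤ nodeCost E δ →
      Slack (gapBound E δ) x c → x + y + L.length * candCost E ≤ slackBound E δ p →
      (∀ c' o x', Node c' q T a b d p j 0 → (∀ k < b, c'.mem k = c.mem k) →
        c'.out = c.out ++ o → Lists (o.map Prod.fst) (ListDesc C E.attr ρ T j L) →
        Slack (gapBound E δ) x' c' → x' + y ≤ slackBound E δ p → WP E M search c' Q) →
      WP E M search c Q := by
  induction L with
  | nil =>
    intro c x hc _ _ _ _ _ _ hx hxy hQ
    refine hQ c [] x hc (fun _ _ => rfl) (by simp) ?_ hx (by simpa using hxy)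
    rw [listDesc_nil]
    exact lists_nil
  | cons Z L ih =>
    intro c x hc hw hL hnd hdisj hy hcand hx hxy hQ
    rw [List.length_cons, Nat.succ_mul] at hy hxy
    have hbe : b ≤ e := by
      have := hw.base_le
      have := hw.le_end
      omega
    obtain ⟨hZsol, hZN⟩ := hL Z List.mem_cons_self
    have hnd' := List.nodup_cons.1 hnd
    refine wp_loop_step (by rw [hc.depth]; omega) ?_
    refine wp_candidate hM hI.pos hc.tick hw.tick hj (by omega) (by omega) hp ?_ ?_
    · intro c' em hc' hw' hA
      have em' := em.of_tick
      refine ih c' (x + candCost E) hc' hw' (fun Z' hZ' => hL Z' (List.mem_cons_of_mem _ hZ'))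
        hnd'.2 (fun X hX Y hY => hdisj X (List.mem_cons_of_mem _ hX) Y (List.mem_cons_of_mem _ hY))
        (by omega) hcand (hx.of_emits_nil em') (by omega) ?_
      intro c₂ o x' hn hm ho hl hs hx'
      obtain ⟨o₁, ho₁, hl₁, -⟩ := em'.out
      obtain rfl := List.map_eq_nil_iff.1 hl₁
      rw [List.append_nil] at ho₁
      refine hQ c₂ o x' hn (fun k hk => (hm k hk).trans (em'.mem k hk)) (ho₁ ▸ ho) ?_ hs hx'
      rw [listDesc_cons_of_not hA]
      exact hl
    · intro c₁ z w em hn₁ hsv hlw hbw hwe hA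
      have em₁ := em.of_tick
      obtain ⟨o₁, ho₁, hl₁, -⟩ := em₁.out
      have hZF : (Z.card + 1) * frameSize E ≤ (N + 1) * frameSize E :=
        Nat.mul_le_mul_right _ (by omega)
      have hjq : (q - j) * itemCost E δ ≤ nodeCost E δ :=
        Nat.mul_le_mul_right _ (Nat.sub_le _ _)
      -- the time since the last output when the descent is complete
      obtain ⟨x₁, hx₁, hb₁⟩ : ∃ x₁, Slack (gapBound E δ) x₁ c₁ ∧
          x₁ + nodeCost E δ ≤ slackBound E δ (1 - p) := by
        rcases Nat.le_one_iff_eq_zero_or_eq_one.1 hp with rfl | rfl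
        · refine ⟨_, hx.of_emits_nil (by simpa using em₁), ?_⟩
          change x + candCost E + _ ≤ _
          simp only [slackBound, Nat.sub_zero, reduceIte, one_ne_zero] at hxy ⊢
          omega
        · refine ⟨_, hx.of_emits_singleton (by simpa using em₁) ?_, ?_⟩
          · change x + candCost E ≤ _
            simp only [slackBound, gapBound, reduceIte, one_ne_zero] at hxy ⊢
            omega
          · change candCost E + _ ≤ _
            simp only [slackBound, Nat.sub_self, reduceIte]
            omega
      refine hS Q Z c₁ z (e + 5) (d + 1) (1 - p) j x₁ hZN hZsol hA.1 hn₁ (by omega) (by omega)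
        (by omega) (by omega) hj hx₁ (by omega) ?_
      intro c₂ o₂ hn₂ hm₂ ho₂ hl₂ hx₂
      have hsv₂ : Saved c₂.mem e a j L.length w b :=
        ⟨(hm₂ _ (by omega)).trans hsv.addr, (hm₂ _ (by omega)).trans hsv.item,
          (hm₂ _ (by omega)).trans hsv.rem, (hm₂ _ (by omega)).trans hsv.next,
          (hm₂ _ (by omega)).trans hsv.base⟩
      refine wp_loop_step (by rw [hn₂.depth]; omega) ?_
      refine wp_pop hM hn₂.tick hsv₂ (by omega) (by simp) ?_
      intro c₃ em₂ hm₃ hk r1 r5 r6 r7 r8 r9 r10 r11 r12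
      have em₃ := em₂.of_tick
      obtain ⟨o₃, ho₃, hl₃, -⟩ := em₃.out
      have hm : ∀ k < e, c₃.mem k = c.mem k := by
        intro k hk
        rw [hm₃, Cfg.tick_mem, hm₂ k (by omega), em₁.mem k hk]
      have hm' : ∀ k < e, c₃.mem k = c₁.mem k := by
        intro k hk
        rw [hm k hk, em₁.mem k hk]
      have hn₃ : Node c₃ q T a b d p j L.length :=
        ⟨hk, r1, r5, r6, r7, by rw [r8]; omega, r9, r10,
          hc.holds.congr hc.below fun k hk => hm k (by omega), hc.below⟩
      have hw₃ : Waiting c₃ b e L :=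
        ⟨by rw [r11]; exact hbw, by
          rw [r11]; exact hlw.congr fun k _ hk => hm' k (by omega), by rw [r11]; exact hwe, r12⟩
      -- the time since the last output when the search has returned
      obtain ⟨x₃, hx₃, hb₃⟩ : ∃ x₃, Slack (gapBound E δ) x₃ c₃ ∧
          x₃ + nodeCost E δ ≤ slackBound E δ p := by
        rcases Nat.le_one_iff_eq_zero_or_eq_one.1 hp with rfl | rfl
        · refine ⟨_, hx₂.of_emits_singleton (by simpa using em₃) ?_, ?_⟩ <;>
          simp only [slackBound, gapBound, Nat.sub_zero, reduceIte, one_ne_zero] <;>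
          omega
        · refine ⟨_, hx₂.of_emits_nil (by simpa using em₃), ?_⟩
          simp only [slackBound, Nat.sub_self, reduceIte, one_ne_zero]
          omega
      refine ih c₃ x₃ hn₃ hw₃ (fun Z' hZ' => hL Z' (List.mem_cons_of_mem _ hZ'))
        hnd'.2 (fun X hX Y hY => hdisj X (List.mem_cons_of_mem _ hX) Y (List.mem_cons_of_mem _ hY))
        (by omega) hcand hx₃ (by omega) ?_
      intro c₄ o₄ x' hn₄ hm₄ ho₄ hl₄ hs₄ hx₄
      refine hQ c₄ (o₁ ++ o₂ ++ o₃ ++ o₄) x' hn₄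
        (fun k hk => (hm₄ k hk).trans (hm k (by omega))) ?_ ?_ hs₄ hx₄
      · rw [ho₄, ho₃, ho₂, ho₁]
        simp
      · rw [listDesc_cons hA]
        have hd₁ : Lists ((o₁ ++ o₂ ++ o₃).map Prod.fst) (Desc C E.attr ρ Z j) := by
          rw [desc_eq_union hZsol hA.1, List.map_append, List.map_append, hl₁, hl₃]
          rcases Nat.le_one_iff_eq_zero_or_eq_one.1 hp with rfl | rfl
          · rw [Set.union_comm]
            simpa using hl₂.append (lists_singleton Z) (disjoint_singleton_properDesc j).symm
          · simpa using (lists_singleton Z).append hl₂ (disjoint_singleton_properDesc j)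
        rw [List.map_append]
        refine hd₁.append hl₄ (Set.disjoint_left.2 ?_)
        rintro X hX ⟨Z', hZ', -, hX'⟩
        refine Set.disjoint_left.1 (hdisj Z List.mem_cons_self Z' (List.mem_cons_of_mem _ hZ') ?_)
          hX hX'
        rintro rfl
        exact hnd'.1 hZ'

theorem candCost_le_nodeCost (hq : 1 ≤ q) (hδ : 1 ≤ δ) : candCost E ≤ nodeCost E δ :=
  calc candCost E ≤ δ * candCost E := Nat.le_mul_of_pos_left _ hδ
    _ ≤ itemCost E δ := Nat.le_add_left _ _
    _ ≤ nodeCost E δ := Nat.le_mul_of_pos_left _ hq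

/-- The search is correct at all sets, by induction on their size. -/
theorem searches (hM : M.Adequate E) (hI : Instance E C ρ δ) (hδ : 1 ≤ δ) (N : ℕ) :
    Searches E M C ρ δ N := by
  induction N with
  | zero =>
    intro Q T c a b d p j x hN hT hpos
    obtain rfl := Finset.card_eq_zero.1 (Nat.le_zero.1 hN)
    exact absurd hpos (not_lt.2 (hI.empty hT.1))
  | succ N hS =>
    intro Q T c a b d p j x hN hT hpos hc hd hdT hb hp hj hx hxB hQ
    have hTne : T.Nonempty := by
      rw [Finset.nonempty_iff_ne_empty]
      rintro rfl
      exact absurd hpos (not_lt.2 (hI.empty hT.1))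
    rcases Nat.le_succ_iff.1 hN with hTN | hTN
    · exact hS Q T c a b d p j x hTN hT hpos hc hd hdT hb hp hj hx hxB hQ
    clear hN
    have hF : frameSize E = E.space₂ + n + 6 := rfl
    have hmul : (T.card + 1) * frameSize E = (N + 1) * frameSize E + frameSize E := by
      rw [hTN, Nat.succ_eq_add_one]; ring
    -- the induction over the items that are left
    obtain ⟨k, hk⟩ : ∃ k, q - j = k := ⟨_, rfl⟩
    induction k generalizing c j x with
    | zero =>
      obtain rfl : j = q := by omega
      refine hQ c [] hc (fun _ _ => rfl) (by simp) ?_ (hx.mono (by omega))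
      rw [properDesc_all hT.1]
      exact lists_nil
    | succ k ih =>
      have hjq : j < q := by omega
      rw [hk, Nat.succ_mul] at hxB
      have hit : itemCost E δ =
        (E.time₂ + 8 * n + 5 * δ + 39 + 1) + δ * candCost E := rfl
      refine wp_loop_step (by rw [hc.depth]; omega) ?_
      refine wp_nextItem hM (i := ⟨j, hjq⟩) hc.tick hd (by omega) (by omega) (by omega)
        hI.length_le hI.count_le ?_ ?_
      · intro c' em hc' hY
        have em' := em.of_tick
        obtain ⟨o, ho, hl, -⟩ := em'.out
        obtain rfl := List.map_eq_nil_iff.1 hl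
        rw [List.append_nil] at ho
        have hD : ProperDesc C E.attr ρ T j = ProperDesc C E.attr ρ T (j + 1) := by
          rcases hY with hY | hY
          · exact properDesc_succ_of_restrictTo_eq_empty hI.mono hI.empty hTne hjq hY
          · exact properDesc_succ_of_mem hjq (mem_commonItems_of_subset_restrictTo hY.ge)
        refine ih c' (j + 1) _ hc' (by omega) (hx.of_emits_nil em') ?_ ?_ (by omega)
        · rw [show q - (j + 1) = k by omega]
          omega
        · intro c₂ o₂ hn hm ho₂ hl₂ hs
          refine hQ c₂ o₂ hn (fun i hi => (hm i hi).trans (em'.mem i hi)) (ho ▸ ho₂) ?_ hs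
          rw [hD]
          exact hl₂
      · intro c' em hc' hw hYne hYT
        have em' := em.of_tick
        obtain ⟨o, ho, hl, -⟩ := em'.out
        obtain rfl := List.map_eq_nil_iff.1 hl
        rw [List.append_nil] at ho
        have hL := hI.mem _ hYne
        set L := E.L₂ (restrictTo E.attr T ⟨j, hjq⟩)
        have hjT : ⟨j, hjq⟩ ∉ commonItems E.attr T := fun h =>
          hYT ((Finset.filter_subset _ _).antisymm (subset_restrictTo subset_rfl h))
        have hYc : (restrictTo E.attr T ⟨j, hjq⟩).card < T.card :=
          Finset.card_lt_card ((Finset.filter_subset _ _).ssubset_of_ne hYT)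
        have hlen : (encodeList L).length ≤ E.space₂ := hI.length_le _ hYne
        have hcnt : L.length * candCost E ≤ δ * candCost E :=
          Nat.mul_le_mul_right _ (hI.count_le _ hYne)
        have hnode : k * itemCost E δ + itemCost E δ ≤ nodeCost E δ := by
          rw [← Nat.succ_mul]
          exact Nat.mul_le_mul_right _ (by omega)
        refine wp_search_list hM hI hS (y := k * itemCost E δ) (by omega) (by omega) (by omega)
          hjq hp L c' _ hc' hw ?_ (hI.nodup _ hYne) ?_ (by omega)
          (candCost_le_nodeCost (by omega) hδ) (hx.of_emits_nil em') (by omega) ?_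
        · intro Z hZ
          have hZm := (hL Z).1 hZ
          have := Finset.card_le_card (mem_maxIn.1 hZm).2.1
          exact ⟨hT.of_mem_maxIn_restrictTo hI.trans hZm, by omega⟩
        · intro Z hZ Z' hZ' hne
          exact disjoint_desc hI.trans ((hL Z).1 hZ) ((hL Z').1 hZ') hne _
        · intro c₂ o₂ x' hn₂ hm₂ ho₂ hl₂ hs₂ hx₂
          refine ih c₂ (j + 1) x' hn₂ (by omega) hs₂ ?_ ?_ (by omega)
          · rw [show q - (j + 1) = k by omega]
            exact hx₂
          · intro c₃ o₃ hn₃ hm₃ ho₃ hl₃ hs₃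
            refine hQ c₃ (o₂ ++ o₃) hn₃ (fun i hi => (hm₃ i hi).trans
              ((hm₂ i hi).trans (em'.mem i hi))) ?_ ?_ hs₃
            · rw [ho₃, ho₂, ho, List.append_assoc]
            · rw [properDesc_succ hI.mono hjq hjT hL, List.map_append]
              exact hl₂.append hl₃ (disjoint_listDesc_properDesc hjq hjT hL)

end Search

/-! ### Bounds for the whole program -/

/-- The initial configuration. -/
def Cfg.init (n q : ℕ) : Cfg n := (State.init n q).cfg

section
variable {n q : ℕ} {E : Env n q} {M : Lim} {C : Finset (Finset (Fin n))}
  {ρ : Finset (Fin n) → ℝ} {δ : ℕ}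

theorem wp_enumerate (hM : M.Adequate E) (hI : Instance E C ρ δ) (hδ : 1 ≤ δ) (hn : 1 ≤ n)
    (hq : 1 ≤ q) (h6 : 6 ≤ M.word)
    (hU : (n + 6) + (E.space₂ + 5) + (n + 1) * frameSize E ≤ M.used) :
    WP E M enumerate (Cfg.init n q) fun c =>
      Lists (c.out.map Prod.fst) {X | IsSolution C E.attr X ∧ 0 < ρ X} ∧
        Slack (gapBound E δ) (gapBound E δ) c := by
  have h1 := hM.one_le
  have h2 := hM.used_le
  have : Nonempty (Fin n) := ⟨⟨0, hn⟩⟩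
  have hV : (Finset.univ : Finset (Fin n)).Nonempty := Finset.univ_nonempty
  have hcard : (Finset.univ : Finset (Fin n)).card = n := by simp
  have hlen := hI.length_le _ hV
  have hcnt := hI.count_le _ hV
  have hmem := hI.mem _ hV
  have hnd := hI.nodup _ hV
  have hLl := length_le_length_encodeList (E.L₂ Finset.univ)
  set L := E.L₂ (Finset.univ : Finset (Fin n)) with hL
  refine wp_seq (wp_block_cons (wp_const h1 (wp_block_nil (wp_seq ?_))))
  refine wp_writeUniv ⟨by simp, ?_⟩ ?_ (by omega) ?_
  · simp [Cfg.init, State.cfg, State.init]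
  · simp [Cfg.init, State.cfg, State.init]
  intro c₁ q₁ hV₁
  have r₁ : ∀ k < 13, c₁.reg k = if k = 2 then 1 else if k = 0 then n else if k = 1 then q
      else 0 := by
    intro k hk
    rw [q₁.reg k hk]
    simp [Cfg.init, State.cfg, State.init]
  have t₁ := q₁.time_le
  have o₁ : c₁.out = [] := q₁.out
  simp [Cfg.init, State.cfg, State.init] at t₁
  refine wp_seq (wp_block_cons (wp_const h6 ?_))
  refine wp_block_add 6 n (by simp) (by simp [r₁]) (by omega) ?_
  refine wp_block_cons (wp_const h1 (wp_block_nil ?_))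
  refine wp_seq (wp_call₂ (Y := Finset.univ) (by simpa [r₁] using hV₁) hV
    (by simp [r₁]; omega) hM.space₂ (by simp [← hL]; omega)
    (fun x hx => (le_of_mem_encodeList hx).trans (by have := hM.depth; omega)) (by rw [← hL]; omega) ?_)
  refine wp_seq (wp_block_cons (wp_move (by simp [r₁]) (wp_block_nil ?_)))
  refine wp_seq (wp_listEnd hM.toBasic (b := n + 7) (L := L) ⟨?_, ?_⟩ ?_ ?_ ?_ ?_)
  · simp [r₁]
  · simp [r₁]
  · simpa using HoldsL.write _ _ _
  · simp [hL]
  · simp; omega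
  intro c₂ q₂ m₂ e₂
  have t₂ := q₂.time_le
  simp at t₂
  have m₂' : c₂.mem = write c₁.mem (6 + n) (encodeList L) := by simpa using m₂
  have hn₂ : Node c₂ q Finset.univ 0 (6 + n) 1 0 0 L.length := by
    refine ⟨⟨?_, ?_⟩, ?_, ?_, ?_, ?_, ?_, ?_, ?_, ?_, by omega⟩
    all_goals try rw [q₂.reg _ (by simp)]
    all_goals try simp [r₁, hL]
    refine hV₁.congr (b := 6 + n) (by omega) fun k hk => ?_
    rw [m₂', write_lt _ _ hk]
  have h11 : c₂.reg 11 = 6 + n := by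
    rw [q₂.reg 11 (by simp)]
    simp
  have hw₂ : Waiting c₂ (6 + n) (6 + n + (encodeList L).length) L :=
    ⟨h11.ge, by rw [h11, m₂']; exact HoldsL.write _ _ _, by rw [h11], by simpa using e₂⟩
  have o₂ : c₂.out = [] := q₂.out.trans o₁
  have hs₂ : Slack (gapBound E δ) (E.time₂ + 4 * n + 5 * δ + 15) c₂ := by
    refine ⟨by simp [o₂], fun t ht => ?_⟩
    simp [o₂] at ht
    omega
  have hcand : L.length * candCost E ≤ δ * candCost E := Nat.mul_le_mul_right _ hcnt
  have hit : itemCost E δ = (E.time₂ + 8 * n + 5 * δ + 40) + δ * candCost E := rfl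
  have hnode : itemCost E δ ≤ nodeCost E δ := Nat.le_mul_of_pos_left _ hq
  refine wp_search_list hM hI (searches hM hI hδ n) (y := 0) le_rfl (by omega) (by omega)
    (Nat.zero_le q) zero_le_one L c₂ _ hn₂ hw₂ ?_ hnd ?_ (by omega)
    (candCost_le_nodeCost hq hδ) hs₂ ?_ ?_
  · exact fun Z hZ => ⟨IsSolution.of_mem_maxIn_univ ((hmem Z).1 hZ), card_le Z⟩
  · exact fun Z hZ Z' hZ' hne => disjoint_desc hI.trans ((hmem Z).1 hZ) ((hmem Z').1 hZ') hne _
  · simp only [slackBound, reduceIte]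
    omega
  intro c₃ o x' hn₃ hm₃ ho₃ hl₃ hs₃ hx₃
  refine wp_loop_step (by rw [hn₃.depth]; simp) ?_
  -- nothing was saved below the list of the ground set: the last return loads meaningless words,
  -- but it sets the depth to zero
  refine wp_pop (e := n + 1) (d := 0) (z := 0) (j' := 0) (p := 0) (Z := Finset.univ) hM
    (by rw [show n + 1 + 5 = 6 + n by ring]; exact hn₃.tick) ⟨rfl, rfl, rfl, rfl, rfl⟩ (by omega)
    (by simp) ?_
  intro c₄ em _ _ _ _ _ h7 _ _ _ _ _
  have em' := em.of_tick
  obtain ⟨o', ho', hl', -⟩ := em'.out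
  obtain rfl : o' = [] := by simpa using hl'
  refine wp_loop_stop h7 ⟨?_, ?_⟩
  · rw [Cfg.tick_out, ho', ho₃, o₂, List.append_nil, List.nil_append]
    refine ⟨hl₃.1, fun X => ?_⟩
    rw [hl₃.2, mem_listDesc_univ hI.mono hmem]
    rfl
  · have hs₄ := hs₃.of_emits_nil (by simpa using em')
    refine ⟨hs₄.chain, fun t ht => ?_⟩
    have := hs₄.last t ht
    simp only [slackBound, gapBound, reduceIte, Cfg.tick_time] at hx₃ ⊢
    omega

theorem delayLE_of_slack {s : State n} {G D : ℕ} (h : Slack G G s.cfg) (hD : G ≤ D) :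
    DelayLE s D := by
  have h' : ((0 :: s.out.map Prod.snd) ++ [s.time]).IsChain fun t t' => t' ≤ t + G := by
    refine List.isChain_append.2 ⟨h.chain, List.isChain_singleton _, fun t ht t' ht' => ?_⟩
    have := h.last t ht
    simp at ht'
    exact ht' ▸ this
  exact h'.imp fun t t' htt => htt.trans (by omega)

theorem within_init {W U S : ℕ} (h : n + q ≤ W) : Within ⟨W, U, S⟩ (State.init n q) := by
  have hn : n ≤ W := by omega
  have hq : q ≤ W := by omega
  refine ⟨fun i => ?_, fun a => Nat.zero_le _, max_le hn hq, Nat.zero_le _, Nat.zero_le _⟩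
  simp only [State.init]
  split_ifs <;> omega

end

theorem gapBound_le {n q : ℕ} (E : Env n q) {δ t : ℕ} (hn : 1 ≤ n) (hq : 1 ≤ q) (hδ : 1 ≤ δ) :
    gapBound E δ ≤ 1000 * (q * E.time₂ + (q * (n + t) + E.timePos) * (q * δ)) := by
  set P := q * n * (q * δ) with hP
  have hqn : 1 ≤ q * n := Nat.mul_pos hq hn
  have hqδ : 1 ≤ q * δ := Nat.mul_pos hq hδ
  have h₁ : q * n ≤ P := Nat.le_mul_of_pos_right _ hqδ
  have h₂ : q * δ ≤ P := Nat.le_mul_of_pos_left _ hqn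
  have h₃ : q ≤ q * n := Nat.le_mul_of_pos_right _ hn
  have h₄ : n ≤ q * n := Nat.le_mul_of_pos_left _ hq
  have h₅ : q * (q * δ) ≤ P := Nat.mul_le_mul_right _ h₃
  have h₆ : q * n * δ ≤ P := Nat.mul_le_mul_left _ (Nat.le_mul_of_pos_left _ hq)
  have e₁ : gapBound E δ = 5 * (q * E.time₂) + 40 * (q * n) + 225 * (q * δ) + 200 * q
      + 5 * (E.timePos * (q * δ)) + 60 * P + 70 * (q * (q * δ)) + 5 * (q * n * δ) + 5 * n + 105 := by
    simp only [gapBound, nodeCost, itemCost, candCost, hP]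
    ring
  have e₂ : q * E.time₂ + (q * (n + t) + E.timePos) * (q * δ)
      = q * E.time₂ + P + q * t * (q * δ) + E.timePos * (q * δ) := by
    rw [hP]
    ring
  omega

end TransSys

theorem theorem1 :
    -- one program and one constant for all inputs
    ∃ (p : TransSys.Prog) (K : ℕ),
      ∀ (n q : ℕ), 1 ≤ n → 1 ≤ q →
      -- the instance on a transitive system, with a volume function
      ∀ (C : Finset (Finset (Fin n))) (σ : Fin n → Finset (Fin q)) (ρ : Finset (Fin n) → ℝ),
      TransSys.IsTransitive C →
      (∀ X Y : Finset (Fin n), X ⊆ Y → ρ X ≤ ρ Y) →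
      (∅ ∈ C → ρ ∅ ≤ 0) →
      -- the upper bound on the number of maximal components
      ∀ (δ : Finset (Fin n) → ℕ),
      (∀ X Y : Finset (Fin n), Y ⊆ X → δ Y ≤ δ X) →
      (∀ X : Finset (Fin n), (TransSys.maxIn C X).card ≤ δ X) →
      1 ≤ δ Finset.univ →
      -- the oracles with their times and spaces
      ∀ (L₁ : Finset (Fin n) → Finset (Fin n) → Finset (Fin n))
        (L₂ : Finset (Fin n) → List (Finset (Fin n)))
        (θ₁t θ₁s θ₂t θ₂s θρt θρs : ℕ),
      TransSys.IsOracle₁ C L₁ →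
      TransSys.IsOracle₂ C L₂ →
      (∀ Y : Finset (Fin n), Y.Nonempty → (TransSys.encodeList (L₂ Y)).length ≤ θ₂s) →
      ∃ s : TransSys.State n,
        TransSys.Run
          { attr := σ, L₁ := L₁, L₂ := L₂, pos := fun X => 0 < ρ X,
            time₁ := θ₁t, time₂ := θ₂t, timePos := θρt,
            space₁ := θ₁s, space₂ := θ₂s, spacePos := θρs }
          p (TransSys.State.init n q) s ∧
        -- each positive solution is output exactly once, and nothing else is
        (s.out.map Prod.fst).Nodup ∧
        (∀ X : Finset (Fin n),
          X ∈ s.out.map Prod.fst ↔ TransSys.IsSolution C σ X ∧ 0 < ρ X) ∧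
        -- delay
        TransSys.DelayLE s
          (K * (q * θ₂t + (q * (n + θ₁t) + θρt) * (q * δ Finset.univ))) ∧
        -- number of memory words, and size of the numbers in them
        s.space ≤ K * ((q + n + θ₁s + θ₂s + θρs) * n) ∧
        s.word ≤ K * ((q + n + θ₁s + θ₂s + θρs) * n) := by
  refine ⟨TransSys.enumerate, 1000, ?_⟩
  intro n q hn hq C σ ρ htrans hmono hempty δ hδmono hδcard hδ L₁ L₂ θ₁t θ₁s θ₂t θ₂s θρt θρs
    _ hL₂ hlen
  set E : TransSys.Env n q :=
    { attr := σ, L₁ := L₁, L₂ := L₂, pos := fun X => 0 < ρ X,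
      time₁ := θ₁t, time₂ := θ₂t, timePos := θρt,
      space₁ := θ₁s, space₂ := θ₂s, spacePos := θρs }
  have hI : TransSys.Instance E C ρ (δ Finset.univ) := by
    refine ⟨htrans, hmono, hempty, fun _ => Iff.rfl, fun Y hY => (hL₂ Y hY).1,
      fun Y hY => (hL₂ Y hY).2, hlen, fun Y hY => ?_⟩
    have h : (L₂ Y).Perm (TransSys.maxIn C Y).toList :=
      (List.perm_ext_iff_of_nodup (hL₂ Y hY).1 (Finset.nodup_toList _)).2 fun Z => by
        rw [(hL₂ Y hY).2, Finset.mem_toList]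
    calc (L₂ Y).length = (TransSys.maxIn C Y).card := by rw [h.length_eq, Finset.length_toList]
      _ ≤ δ Y := hδcard Y
      _ ≤ δ Finset.univ := hδmono _ _ (Finset.subset_univ Y)
  set U := (n + 6) + (θ₂s + 5) + (n + 1) * (θ₂s + n + 6) with hU
  set W := U + n * n + (n + 2) * q + 6 with hW
  have hM : TransSys.Lim.Adequate ⟨W, U, θ₂s + θρs⟩ E :=
    { used_le := by change U ≤ W; omega
      one_le := by change 1 ≤ W; omega
      card_mul_card := by change n * n ≤ W; omega
      depth_mul_item := by change (n + 2) * q ≤ W; omega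
      depth := by change n + 2 ≤ W; omega
      space₂ := Nat.le_add_right _ _
      spacePos := Nat.le_add_left _ _ }
  have hqq : q ≤ (n + 2) * q := Nat.le_mul_of_pos_left q (by omega)
  obtain ⟨s, hrun, hs, ⟨hnd, hmem⟩, hslack⟩ := TransSys.wp_enumerate hM hI hδ hn hq
    (by change 6 ≤ W; omega) le_rfl (TransSys.State.init n q) rfl
    (TransSys.within_init (by omega))
  -- both bounds on the space are sums of multiples of the products below
  have hWX : W + (θ₂s + θρs) ≤ 1000 * ((q + n + θ₁s + θ₂s + θρs) * n) := by
    have e : (q + n + θ₁s + θ₂s + θρs) * n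
        = q * n + n * n + θ₁s * n + θ₂s * n + θρs * n := by ring
    have e' : U = θ₂s * n + n * n + 8 * n + 2 * θ₂s + 17 := by rw [hU]; ring
    have e'' : (n + 2) * q = q * n + 2 * q := by ring
    have h₁ : q ≤ q * n := Nat.le_mul_of_pos_right _ hn
    have h₂ : n ≤ n * n := Nat.le_mul_of_pos_right _ hn
    have h₃ : θ₂s ≤ θ₂s * n := Nat.le_mul_of_pos_right _ hn
    have h₄ : θρs ≤ θρs * n := Nat.le_mul_of_pos_right _ hn
    omega
  refine ⟨s, hrun, hnd, fun X => hmem X, ?_, ?_, ?_⟩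
  · exact TransSys.delayLE_of_slack hslack (TransSys.gapBound_le E hn hq hδ)
  · have h₁ : s.used ≤ U := hs.used
    have h₂ : s.work ≤ θ₂s + θρs := hs.work
    unfold TransSys.State.space
    omega
  · have h₁ : s.word ≤ W := hs.word
    omega
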